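/- Let $k$ be a field of characteristic different from $2$ and $3$, let $C\subset\mathbb P^2$ be a smooth plane cubic over $k$ with equation $F(X,Y,Z)=0$, and let $O\in C(k)$ be a $k$-rational flex. Let $\hat{\mathbb P}$ be the dual plane, where $[U:V:W]$ stands for the line $UX+VY+WZ=0$; let $\hat C\subset\hat{\mathbb P}$ be the dual curve of $C$ (the Zariski closure of the image of the Gauss map $[X:Y:Z]\mapsto[F_X:F_Y:F_Z]$), with reduced equation $G=0$; and let $\hat O\in\hat{\mathbb P}(k)$ be the cusp of $\hat C$ given by the tangent to $C$ at $O$. A rational curve over $k$ in $\hat{\mathbb P}$ is a curve $L$ with a parametrization $t\mapsto[U(t):V(t):W(t)]$ by coprime polynomials in $k[t]$ that is birational onto $L$. It meets $\hat C$ with only even multiplicities if $L\not\subset\hat C$ and, at every $\bar k$-point of the normalization $\mathbb P^1$ of $L$, the pull-back of $G$ vanishes to even order. A pseudo-parameterization of $C$ (by cubic radicals) is a non-constant point $P_t$ of $C$ with coordinates in a field $k(t)(\sqrt[3]{R(t)})$ for some $R\in k(t)$; two of them, $P_t$ and $Q_t$, are equivalent if $Q_t=P_{\varphi(t)}$ for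 some birational change of variable $\varphi$ over $k$, with some choice of the radicals. Then there is an infinite sequence of pairwise distinct rational curves $L_0,L_1,L_2,\dots$ over $k$ in $\hat{\mathbb P}$, each meeting $\hat C$ with only even multiplicities, and a sequence of pairwise inequivalent pseudo-parameterizations $P_0,P_1,P_2,\dots$ of $C$, such that for every $n$ the point $P_{n,t}$ lies on the line $D_{n,t}$ of $\mathbb P^2$ that corresponds to the point of $L_n$ with parameter $t$. Moreover the $L_n$ can be chosen to be sections of the pencil of lines through $\hat O$: projection from $\hat O$ induces a birational map from $L_n$ to the pencil. -/

import Mathlib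

open scoped LinearAlgebra.Projectivization Polynomial Matrix

namespace CubicRadicals

noncomputable section

/-! ### Plane cubics, flexes and dual curves

Points of the plane and of the dual plane are given by homogeneous coordinates; the point
`[U : V : W]` of the dual plane is the line `U X + V Y + W Z = 0`. -/

/-- The gradient `(F_X, F_Y, F_Z)` of a ternary form at a point with coordinates in `A`. -/
def gradient {k A : Type*} [CommRing k] [CommRing A] [Algebra k A]
    (F : MvPolynomial (Fin 3) k) (x : Fin 3 → A) : Fin 3 → A :=
  fun i => MvPolynomial.aeval x (MvPolynomial.pderiv i F)

/-- `F` is the equation of a smooth plane cubic over `k`. -/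
structure IsSmoothCubic {k : Type*} [Field k] (F : MvPolynomial (Fin 3) k) : Prop where
  homogeneous : F.IsHomogeneous 3
  smooth : ∀ x : Fin 3 → AlgebraicClosure k, x ≠ 0 →
    MvPolynomial.aeval x F = 0 → gradient F x ≠ 0

/-- `p` is (a coordinate vector of) a `k`-rational flex of `F = 0`: a point of the curve such that
the tangent line at `p` meets the curve at `p` with multiplicity at least three. Here `q` runs
through the tangent line, and `s ↦ p + s q` parametrizes a neighbourhood of `p` in it. -/
structure IsFlex {k : Type*} [Field k] (F : MvPolynomial (Fin 3) k) (p : Fin 3 → k) : Prop where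
  ne_zero : p ≠ 0
  mem : MvPolynomial.aeval p F = 0
  flex : ∀ q : Fin 3 → k, gradient F p ⬝ᵥ q = 0 →
    (Polynomial.X : k[X]) ^ 3 ∣
      MvPolynomial.aeval (fun i => Polynomial.C (p i) + Polynomial.X * Polynomial.C (q i)) F

/-- The affine cone over the image of the Gauss map `[X:Y:Z] ↦ [F_X : F_Y : F_Z]`, over the
algebraic closure of `k`. -/
def gaussCone {k : Type*} [Field k] (F : MvPolynomial (Fin 3) k) :
    Set (Fin 3 → AlgebraicClosure k) :=
  {y | ∃ x : Fin 3 → AlgebraicClosure k, x ≠ 0 ∧ MvPolynomial.aeval x F = 0 ∧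
    ∃ c : AlgebraicClosure k, y = c • gradient F x}

/-- `G = 0` is the (reduced) equation of the dual curve: `G` generates the ideal of all polynomials
vanishing on the image of the Gauss map, that is, the ideal of its Zariski closure. -/
def IsDualEquation {k : Type*} [Field k] (F : MvPolynomial (Fin 3) k)
    (G : MvPolynomial (Fin 3) (AlgebraicClosure k)) : Prop :=
  MvPolynomial.vanishingIdeal (AlgebraicClosure k) (gaussCone F) = Ideal.span {G}

/-! ### Rational curves in the dual plane -/

/-- The map `t ↦ [v 0 (t) : v 1 (t) : v 2 (t)]` is birational onto its image: the ratios of the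
coordinates generate the field `k(t)`. (Ratios with denominator zero are `0` and do no harm.) -/
def IsProper {k : Type*} [Field k] (v : Fin 3 → k[X]) : Prop :=
  IntermediateField.adjoin k
    (Set.range fun ij : Fin 3 × Fin 3 =>
      (algebraMap k[X] (RatFunc k) (v ij.1) / algebraMap k[X] (RatFunc k) (v ij.2))) = ⊤

/-- A rational curve over `k` in the dual plane, through a parametrization
`t ↦ [U(t) : V(t) : W(t)]` by coprime polynomials which is birational onto the curve. -/
structure RationalCurve (k : Type*) [Field k] where
  coord : Fin 3 → k[X]
  coprime : Ideal.span (Set.range coord) = ⊤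
  proper : IsProper coord

namespace RationalCurve

variable {k : Type*} [Field k]

/-- The degree of the parametrization. -/
def degree (L : RationalCurve k) : ℕ :=
  Finset.univ.sup fun i => (L.coord i).natDegree

/-- The homogeneous coordinates of the parametrization as polynomials in a local parameter at a
point `τ` of the projective line over the algebraic closure of `k`: the parameter is `t - τ` for
finite `τ`, and `1 / t` at infinity (where the coordinates are multiplied by `t ^ (-degree)`). -/
def localCoord (L : RationalCurve k) (τ : OnePoint (AlgebraicClosure k)) :
    Fin 3 → (AlgebraicClosure k)[X] :=
  fun i => τ.elim
    ((Polynomial.reflect L.degree (L.coord i)).map (algebraMap k (AlgebraicClosure k)))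
    (fun r => Polynomial.taylor r ((L.coord i).map (algebraMap k (AlgebraicClosure k))))

/-- The set of points of the curve over the algebraic closure. -/
def carrier (L : RationalCurve k) :
    Set (ℙ (AlgebraicClosure k) (Fin 3 → AlgebraicClosure k)) :=
  {x | ∃ (τ : OnePoint (AlgebraicClosure k))
    (h : (fun i => (L.localCoord τ i).eval 0) ≠ 0),
    x = Projectivization.mk (AlgebraicClosure k) _ h}

/-- The restriction of the form `G` to the curve, in the local parameter at `τ`. -/
def restrict (L : RationalCurve k) (G : MvPolynomial (Fin 3) (AlgebraicClosure k))
    (τ : OnePoint (AlgebraicClosure k)) : (AlgebraicClosure k)[X] :=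
  MvPolynomial.aeval (L.localCoord τ) G

/-- The curve meets the dual of the curve `F = 0` with only even multiplicities: it is not contained
in the dual curve and, at each point `τ` of its normalization, the equation of the dual curve
vanishes to even order (possibly zero). -/
def MeetsDualEvenly (L : RationalCurve k) (F : MvPolynomial (Fin 3) k) : Prop :=
  ∃ G : MvPolynomial (Fin 3) (AlgebraicClosure k), IsDualEquation F G ∧
    ∀ τ : OnePoint (AlgebraicClosure k),
      L.restrict G τ ≠ 0 ∧ Even ((L.restrict G τ).rootMultiplicity 0)

/-- The curve is a section of the pencil of lines through the point `[b]` of the dual plane: sending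
a point of the curve to the line joining it to `[b]` is a birational map from the curve to the
pencil. (The line joining `[b]` and `[u]` has coordinates `b ⨯₃ u`.) -/
def IsSectionOfPencil (L : RationalCurve k) (b : Fin 3 → k) : Prop :=
  IsProper ((fun i => Polynomial.C (b i)) ⨯₃ L.coord)

end RationalCurve

/-! ### Pseudo-parameterizations -/

/-- A pseudo-parameterization (parameterization by cubic radicals) of the curve `F = 0`: a
non-constant point of the curve with coordinates in `k(t)(ρ)`, where `ρ ^ 3 = R ∈ k(t)`.
All radicals are taken in a fixed algebraic closure of `k(t)`. -/
structure PseudoParam {k : Type*} [Field k] (F : MvPolynomial (Fin 3) k) where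
  radicand : RatFunc k
  root : AlgebraicClosure (RatFunc k)
  root_pow : root ^ 3 = algebraMap (RatFunc k) (AlgebraicClosure (RatFunc k)) radicand
  coord : Fin 3 → AlgebraicClosure (RatFunc k)
  coord_mem : ∀ i, coord i ∈ IntermediateField.adjoin (RatFunc k) {root}
  on_curve : MvPolynomial.aeval coord F = 0
  nonconstant : ∃ i j, Transcendental k (coord i / coord j)

namespace PseudoParam

variable {k : Type*} [Field k] {F : MvPolynomial (Fin 3) k}

/-- Two pseudo-parameterizations `P` and `Q` are equivalent if `Q_t = P_{φ(t)}` for a birational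
change of variable `φ` (for some choice of the radicals, that is, for some extension `σ` of `φ` to
the algebraic closure of `k(t)`); the equality is one of points of the projective plane. -/
def Equivalent (P Q : PseudoParam F) : Prop :=
  ∃ (φ : RatFunc k ≃ₐ[k] RatFunc k)
    (σ : AlgebraicClosure (RatFunc k) ≃+* AlgebraicClosure (RatFunc k)),
    (∀ f : RatFunc k, σ (algebraMap _ _ f) = algebraMap _ _ (φ f)) ∧
    ∃ c : AlgebraicClosure (RatFunc k), c ≠ 0 ∧ ∀ i, Q.coord i = c * σ (P.coord i)

/-- The pseudo-parameterization `t ↦ P_t` is given by the rational curve `t ↦ D_t` in the dual plane: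
`P_t` is one of the intersection points of the cubic with the line `D_t`. -/
def IsGivenBy (P : PseudoParam F) (L : RationalCurve k) : Prop :=
  ∑ i, algebraMap (RatFunc k) (AlgebraicClosure (RatFunc k))
    (algebraMap k[X] (RatFunc k) (L.coord i)) * P.coord i = 0

end PseudoParam

end

end CubicRadicals

/-! In Weierstrass coordinates (`exists_weierstrass_form`) the flex is the point at infinity of `y²
= x³ + ax + b`, its tangent is the line at infinity, and the pencil through the cusp of the dual
curve is parametrized by the slope `t`. A section of the pencil is thus a family of lines `y = t x +
c` with `c ∈ k(t)`. The dual equation at such a line is the discriminant `lineDisc` of the cubic in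
`x` that cuts out the three intersection points (`isDualEquation_subst`). If `-3 · lineDisc = w²`
with `w ∈ k(t)`, the section meets the dual curve evenly, and Cardano's formula needs no square root
beyond `w`: a single cube root gives an intersection point (`exists_cubic_radical`).

It remains to find infinitely many such `c`. As a polynomial in `c`, `-3 · lineDisc` is a quartic
with leading coefficient `81 = 9²`, so `w² = -3 · lineDisc` is a genus one curve over `k(t)` with
two rational points at infinity. Taking one of them as origin yields a Weierstrass equation with
coefficients `jacA`, `jacB`, on which the other one becomes an explicit point. That point, or its
double when `a = 0`, avoids the singular points of all finite fibres. Hence no cancellation occurs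
in the duplication formula, the degree of the abscissa is multiplied by four at each doubling
(`IsAdmissible.double`), and there are infinitely many points (`infinite_setOf_lineDisc`).

The pseudo-parameterizations are non-constant and inequivalent because the cubic in `x` has no root
in `k(t)` (`cubic_ne_zero`). Indeed a root would be a point of the elliptic curve over `k(t)`, hence
constant by a Fermat descent (`exists_C_eq_of_weierstrass`), and for lines through a fixed point the
discriminant condition fails. So an intersection point has an abscissa outside `k(t)`, which
determines the line of the family on which it lies and thereby `c` (`eq_of_equivalent`). -/

namespace CubicRadicals

/-! ### Fermat descent: an elliptic curve over `k` has only constant points over `k(t)` -/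

section Descent

open Polynomial

variable {κ : Type*} [Field κ]

theorem isSquare_C_algClosed [IsAlgClosed κ] (c : κ) : IsSquare (C c : κ[X]) := by
  obtain ⟨d, hd⟩ := IsAlgClosed.exists_eq_mul_self c
  exact ⟨C d, by rw [hd, C_mul]⟩

/-- By unique factorization each factor is a square up to a unit, and units are constants, which are
squares over an algebraically closed field. -/
theorem isSquare_of_isCoprime_mul [IsAlgClosed κ] {a b : κ[X]} (h : IsCoprime a b) (hs : IsSquare (a * b)) :
    IsSquare a := by
  obtain ⟨c, hc⟩ := hs
  obtain ⟨d, u, hu⟩ := exists_associated_pow_of_mul_eq_pow' (k := 2) h (by rw [hc, sq])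
  obtain ⟨r, -, hr⟩ := isUnit_iff.mp u.isUnit
  rw [← hu, ← hr, sq]
  exact (IsSquare.mul_self d).mul (isSquare_C_algClosed r)

theorem isCoprime_C_combination {a b : κ[X]} (h : IsCoprime a b) {p q r s : κ}
    (hd : p * s - q * r ≠ 0) : IsCoprime (C p * a + C q * b) (C r * a + C s * b) := by
  obtain ⟨x, y, hxy⟩ := h
  have e : C (p * s - q * r)⁻¹ * (C p * C s - C q * C r) = (1 : κ[X]) := by
    rw [← C_mul, ← C_mul, ← C_sub, ← C_mul, inv_mul_cancel₀ hd, C_1]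
  refine ⟨C (p * s - q * r)⁻¹ * (x * C s - y * C r), C (p * s - q * r)⁻¹ * (y * C p - x * C q), ?_⟩
  linear_combination (x * a + y * b) * e + hxy

/-- Two coprime polynomials such that four members of the pencil they span are squares are
constant. -/
theorem natDegree_eq_zero_of_four_squares [IsAlgClosed κ] (h2 : (2 : κ) ≠ 0) (n : ℕ) :
    ∀ (u v : κ[X]) (e : κ), IsCoprime u v → e ≠ 0 → e ≠ 1 → IsSquare u → IsSquare v →
      IsSquare (u - v) → IsSquare (u - C e * v) → u.natDegree ≤ n → v.natDegree ≤ n →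
      u.natDegree = 0 ∧ v.natDegree = 0 := by
  induction n using Nat.strong_induction_on with
  | _ n ih =>
  rintro u v e huv he0 he1 ⟨U, rfl⟩ ⟨V, rfl⟩ h3 h4 hu hv
  rcases Nat.eq_zero_or_pos n with rfl | hn
  · omega
  obtain ⟨f, hf⟩ := IsAlgClosed.exists_eq_mul_self e
  have hUV : IsCoprime U V := huv.of_mul_left_left.of_mul_right_left
  have hf0 : f ≠ 0 := by rintro rfl; simp at hf; exact he0 hf
  have hf1 : 1 - f ≠ 0 := fun h => he1 (by rw [hf, ← sub_eq_zero.mp h, mul_one])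
  have hf2 : 1 + f ≠ 0 := fun h => he1 (by rw [hf, eq_neg_of_add_eq_zero_right h]; ring)
  -- `U² - g²V²` splits into two coprime factors, so both are squares. For `g = 1` and `g = f`, with
  -- `f² = e`, this gives four square members in the pencil of `U` and `V`, whose degrees are half
  -- the old ones.
  have key : ∀ g : κ, g ≠ 0 → IsSquare (U * U - C (g * g) * (V * V)) →
      IsSquare (U - C g * V) ∧ IsSquare (U + C g * V) := by
    intro g hg hs
    have hc : IsCoprime (U - C g * V) (U + C g * V) := by
      have := isCoprime_C_combination hUV (p := 1) (q := -g) (r := 1) (s := g)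
        (by ring_nf; exact mul_ne_zero hg h2)
      simpa [sub_eq_add_neg] using this
    have hs' : IsSquare ((U - C g * V) * (U + C g * V)) := by
      convert hs using 1; rw [C_mul]; ring
    exact ⟨isSquare_of_isCoprime_mul hc hs',
      isSquare_of_isCoprime_mul hc.symm (by rwa [mul_comm])⟩
  obtain ⟨s1, s2⟩ := key 1 one_ne_zero (by simpa using h3)
  obtain ⟨s3, s4⟩ := key f hf0 (by rwa [← hf])
  rw [C_1, one_mul] at s1 s2
  rw [← sq, natDegree_pow] at hu hv
  have hC : ∀ x y : κ, (x = y) → (C x : κ[X]) = C y := fun x y h => by rw [h]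
  -- `α` and `β` solve `α - β = 1`, `α + β = f`, so that `α(U - V) - β(U + V) = U - fV`. The fourth
  -- square `U + fV` is then proportional to `u' - (α/β)² v'` for the new pair `u' = α(U - V)`, `v'
  -- = β(U + V)`.
  set α : κ := (1 + f) / 2
  set β : κ := -((1 - f) / 2)
  have hα : α ≠ 0 := div_ne_zero hf2 h2
  have hβ : β ≠ 0 := neg_ne_zero.mpr (div_ne_zero hf1 h2)
  have e1 : α - β = 1 := by simp only [α, β]; field_simp; ring
  have e2 : α + β = f := by simp only [α, β]; field_simp; ring
  clear_value α β
  have e1' : C α - C β = (1 : κ[X]) := by rw [← C_sub, e1, C_1]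
  have e2' : C α + C β = (C f : κ[X]) := by rw [← C_add, e2]
  have hdeg : ∀ x y : κ, (C x * (U - V) + C y * (U + V)).natDegree ≤ n / 2 := by
    intro x y
    have hU : U.natDegree ≤ n / 2 := by omega
    have hV : V.natDegree ≤ n / 2 := by omega
    refine natDegree_add_le_of_degree_le ?_ ?_
    · exact (natDegree_C_mul_le _ _).trans ((natDegree_sub_le_of_le hU hV).trans (max_self _).le)
    · exact (natDegree_C_mul_le _ _).trans (natDegree_add_le_of_degree_le hU hV)
  have main := ih (n / 2) (by omega) (C α * (U - V)) (C β * (U + V)) ((α / β) ^ 2)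
    (by
      have := isCoprime_C_combination hUV (p := α) (q := -α) (r := β) (s := β)
        (by ring_nf; exact mul_ne_zero (mul_ne_zero hα hβ) h2)
      simpa [mul_sub, mul_add, sub_eq_add_neg] using this)
    (pow_ne_zero _ (div_ne_zero hα hβ))
    (by
      rw [div_pow, Ne, div_eq_one_iff_eq (pow_ne_zero _ hβ)]
      intro h
      apply hf0
      rw [← e2, ← mul_one (α + β), ← e1]
      linear_combination h)
    ((isSquare_C_algClosed α).mul s1) ((isSquare_C_algClosed β).mul s2)
    (by convert s3 using 1; linear_combination U * e1' - V * e2')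
    (by
      have h5 : C α * (U - V) - C ((α / β) ^ 2) * (C β * (U + V))
          = C (-(α / β)) * (U + C f * V) := by
        have : (C ((α / β) ^ 2) : κ[X]) * C β = C (α / β) * C α := by
          rw [← C_mul, ← C_mul]; apply hC; field_simp
        have h6 : (C α : κ[X]) = C (α / β) * C β := by
          rw [← C_mul]; apply hC; field_simp
        rw [← e2', C_neg]
        linear_combination -(U + V) * this + (U - V) * h6 - C (α / β) * U * e1'
      rw [h5]
      exact (isSquare_C_algClosed _).mul s4)
    (by simpa using hdeg α 0) (by simpa using hdeg 0 β)
  rw [natDegree_C_mul hα, natDegree_C_mul hβ] at main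
  have hU : U.natDegree ≤ 0 := by
    have : U = C (2⁻¹ : κ) * ((U - V) + (U + V)) := by
      have : (C (2⁻¹ : κ) * 2 : κ[X]) = 1 := by
        rw [← C_ofNat, ← C_mul, inv_mul_cancel₀ h2, C_1]
      linear_combination -U * this
    rw [this]
    exact (natDegree_C_mul_le _ _).trans
      (natDegree_add_le_of_degree_le main.1.le main.2.le)
  have hV : V.natDegree ≤ 0 := by
    have : V = (U + V) - U := by ring
    rw [this]
    exact (natDegree_sub_le_of_le main.2.le hU).trans (max_self _).le
  rw [← sq, ← sq, natDegree_pow, natDegree_pow]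
  omega

theorem exists_depressed_cubic_roots [IsAlgClosed κ] (a b : κ) :
    ∃ e₁ e₂ e₃ : κ, e₁ + e₂ + e₃ = 0 ∧ e₁ * e₂ + e₁ * e₃ + e₂ * e₃ = a ∧ e₁ * e₂ * e₃ = -b := by
  obtain ⟨e₁, h₁⟩ := IsAlgClosed.exists_root (X ^ 3 + C a * X + C b : κ[X])
    (by rw [show (X ^ 3 + C a * X + C b : κ[X]).degree = 3 by compute_degree!]; norm_num)
  obtain ⟨e₂, h₂⟩ := IsAlgClosed.exists_root (X ^ 2 + C e₁ * X + C (a + e₁ ^ 2) : κ[X])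
    (by
      rw [show (X ^ 2 + C e₁ * X + C (a + e₁ ^ 2) : κ[X]).degree = 2 by compute_degree!]
      norm_num)
  simp only [IsRoot.def, eval_add, eval_pow, eval_X, eval_mul, eval_C] at h₁ h₂
  refine ⟨e₁, e₂, -e₁ - e₂, by ring, ?_, ?_⟩
  · linear_combination -h₂
  · linear_combination h₁ - e₁ * h₂

/-- A rational function whose square is a polynomial is integral over `k[X]`, which is integrally
closed. -/
theorem exists_algebraMap_eq_of_sq_eq {k : Type*} [Field k] {f : RatFunc k} {g : k[X]}
    (h : f ^ 2 = algebraMap k[X] (RatFunc k) g) :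
    ∃ s : k[X], algebraMap k[X] (RatFunc k) s = f ∧ s ^ 2 = g := by
  obtain ⟨s, hs⟩ := IsIntegrallyClosed.algebraMap_eq_of_integral (R := k[X]) (x := f)
    (by apply IsIntegral.of_pow (n := 2) (by norm_num); rw [h]; exact isIntegral_algebraMap)
  refine ⟨s, hs, ?_⟩
  apply IsFractionRing.injective k[X] (RatFunc k)
  rw [map_pow, hs, h]

/-- A smooth Weierstrass cubic has no non-constant points over a rational function field. -/
theorem exists_C_eq_of_weierstrass {k : Type*} [Field k] (h2 : (2 : k) ≠ 0) {a b : k}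
    (hd : 4 * a ^ 3 + 27 * b ^ 2 ≠ 0) {x y : RatFunc k}
    (h : y ^ 2 = x ^ 3 + RatFunc.C a * x + RatFunc.C b) : ∃ x₀ : k, x = RatFunc.C x₀ := by
  set P := x.num
  set Q := x.denom
  have hQ : algebraMap k[X] (RatFunc k) Q ≠ 0 := by
    simpa using x.denom_ne_zero
  have hx : x * algebraMap k[X] (RatFunc k) Q = algebraMap k[X] (RatFunc k) P := by
    conv_lhs => rw [← RatFunc.num_div_denom x]
    exact div_mul_cancel₀ _ hQ
  -- Multiplying the equation by `Q⁴` makes the right side `Q` times a binary cubic form in `P, Q`.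
  -- Over the algebraic closure it is a product of four pairwise coprime members of the pencil of
  -- `P` and `Q`, so each is a square.
  obtain ⟨s, -, hs⟩ := exists_algebraMap_eq_of_sq_eq
    (f := y * algebraMap k[X] (RatFunc k) Q ^ 2)
    (g := Q * (P ^ 3 + C a * P * Q ^ 2 + C b * Q ^ 3)) (by
      simp only [map_mul, map_add, map_pow, RatFunc.algebraMap_C, ← hx]
      rw [mul_pow, h]; ring)
  let κ := AlgebraicClosure k
  let φ : k[X] →+* κ[X] := mapRingHom (algebraMap k κ)
  have h2' : (2 : κ) ≠ 0 := by
    rw [← map_ofNat (algebraMap k κ) 2]; exact (_root_.map_ne_zero _).mpr h2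
  obtain ⟨e₁, e₂, e₃, he, ha, hb⟩ :=
    exists_depressed_cubic_roots (algebraMap k κ a) (algebraMap k κ b)
  have hd' : 4 * algebraMap k κ a ^ 3 + 27 * algebraMap k κ b ^ 2 ≠ 0 := by
    intro H; apply hd
    apply (algebraMap k κ).injective
    simpa only [map_add, map_mul, map_pow, map_ofNat, map_zero] using H
  have hdis : (e₁ - e₂) ^ 2 * (e₁ - e₃) ^ 2 * (e₂ - e₃) ^ 2 ≠ 0 := by
    intro H; apply hd'
    obtain rfl : e₃ = -e₁ - e₂ := by linear_combination he
    rw [← ha, ← neg_neg (algebraMap k κ b), ← hb]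
    linear_combination -H
  have h12 : e₂ - e₁ ≠ 0 := fun H => hdis (by rw [sub_eq_zero.mp H]; ring)
  have h13 : e₃ - e₁ ≠ 0 := fun H => hdis (by rw [sub_eq_zero.mp H]; ring)
  have h23 : e₃ - e₂ ≠ 0 := fun H => hdis (by rw [sub_eq_zero.mp H]; ring)
  have hcop : IsCoprime (φ P) (φ Q) := (RatFunc.isCoprime_num_denom x).map φ
  have hsq : φ Q * ((φ P - C e₁ * φ Q) * (φ P - C e₂ * φ Q) * (φ P - C e₃ * φ Q)) = φ s ^ 2 := by
    rw [← map_pow, hs]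
    simp only [map_mul, map_add, map_pow]
    have ca : φ (C a) = C e₁ * C e₂ + C e₁ * C e₃ + C e₂ * C e₃ := by
      simp only [← C_mul, ← C_add, ha]; simp [φ]
    have cb : φ (C b) = -(C e₁ * C e₂ * C e₃) := by
      simp only [← C_mul, ← C_neg, hb]; simp [φ]
    have ce : (C e₁ + C e₂ + C e₃ : κ[X]) = 0 := by
      simp only [← C_add, he, C_0]
    rw [ca, cb]
    linear_combination -(φ P) ^ 2 * (φ Q) ^ 2 * ce
  have c0 : ∀ e : κ, IsCoprime (φ Q) (φ P - C e * φ Q) := by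
    intro e
    have := isCoprime_C_combination hcop (p := 0) (q := 1) (r := 1) (s := -e) (by simp)
    simpa [sub_eq_add_neg] using this
  have c1 : ∀ e e' : κ, e' - e ≠ 0 → IsCoprime (φ P - C e * φ Q) (φ P - C e' * φ Q) := by
    intro e e' h
    have := isCoprime_C_combination hcop (p := 1) (q := -e) (r := 1) (s := -e')
      (by intro H; apply h; linear_combination -H)
    simpa [sub_eq_add_neg] using this
  have sQ : IsSquare (φ Q) := isSquare_of_isCoprime_mul
    (((c0 e₁).mul_right (c0 e₂)).mul_right (c0 e₃)) ⟨φ s, by rw [hsq, sq]⟩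
  have s1 : IsSquare (φ P - C e₁ * φ Q) := isSquare_of_isCoprime_mul
    (((c0 e₁).symm.mul_right (c1 e₁ e₂ h12)).mul_right (c1 e₁ e₃ h13))
    ⟨φ s, by rw [← sq, ← hsq]; ring⟩
  have s2 : IsSquare (φ P - C e₂ * φ Q) := isSquare_of_isCoprime_mul
    (((c0 e₂).symm.mul_right (c1 e₁ e₂ h12).symm).mul_right (c1 e₂ e₃ h23))
    ⟨φ s, by rw [← sq, ← hsq]; ring⟩
  have s3 : IsSquare (φ P - C e₃ * φ Q) := isSquare_of_isCoprime_mul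
    (((c0 e₃).symm.mul_right (c1 e₁ e₃ h13).symm).mul_right (c1 e₂ e₃ h23).symm)
    ⟨φ s, by rw [← sq, ← hsq]; ring⟩
  -- The base change of the pencil that sends `e₁` to `0` and `e₂` to `1`; the third root goes to
  -- `(e₃ - e₁) / (e₂ - e₁)`.
  have main := natDegree_eq_zero_of_four_squares h2' _ (φ P - C e₁ * φ Q) (C (e₂ - e₁) * φ Q)
    ((e₃ - e₁) / (e₂ - e₁))
    (by
      have := isCoprime_C_combination hcop (p := 1) (q := -e₁) (r := 0) (s := e₂ - e₁)
        (by simpa using h12)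
      simpa [sub_eq_add_neg] using this)
    (div_ne_zero h13 h12)
    (by rw [Ne, div_eq_one_iff_eq h12]; intro H; apply h23; linear_combination H)
    s1 ((isSquare_C_algClosed _).mul sQ)
    (by convert s2 using 1; rw [C_sub]; ring)
    (by
      convert s3 using 1
      rw [← mul_assoc, ← C_mul, div_mul_cancel₀ _ h12, C_sub]; ring)
    (le_max_left _ _) (le_max_right _ _)
  have dQ : (φ Q).natDegree = 0 := by rw [← main.2, natDegree_C_mul h12]
  have dP : (φ P).natDegree = 0 := by
    have : φ P = (φ P - C e₁ * φ Q) + C e₁ * φ Q := by ring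
    rw [this]
    have := natDegree_add_le_of_degree_le main.1.le ((natDegree_C_mul_le e₁ (φ Q)).trans dQ.le)
    omega
  have dφ : ∀ f : k[X], (φ f).natDegree = f.natDegree := fun f =>
    natDegree_map_eq_of_injective (algebraMap k κ).injective f
  rw [dφ] at dQ dP
  refine ⟨P.coeff 0 / Q.coeff 0, ?_⟩
  rw [← RatFunc.num_div_denom x, map_div₀, ← RatFunc.algebraMap_C, ← RatFunc.algebraMap_C,
    ← eq_C_of_natDegree_eq_zero dP, ← eq_C_of_natDegree_eq_zero dQ]

end Descent

/-! ### Doubling without cancellation and growth of degrees -/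

section Doubling

open Polynomial

/-- These are the numerator and denominator of the duplication formula `(f'² - 8xf) / (4f)` at `x =
p / q`. A common zero with `q ≠ 0` is a common zero of `f` and `f'`, that is, a singular point. -/
theorem doubling_ne_zero {κ : Type*} [Field κ] (h2 : (2 : κ) ≠ 0) {a b p q : κ}
    (h₁ : p ≠ 0 ∨ q ≠ 0)
    (h : p ^ 3 + a * p * q ^ 2 + b * q ^ 3 ≠ 0 ∨ 3 * p ^ 2 + a * q ^ 2 ≠ 0) :
    (3 * p ^ 2 + a * q ^ 2) ^ 2 - 8 * p * (p ^ 3 + a * p * q ^ 2 + b * q ^ 3) ≠ 0 ∨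
      4 * q * (p ^ 3 + a * p * q ^ 2 + b * q ^ 3) ≠ 0 := by
  by_contra! H
  obtain ⟨hN, hq⟩ := H
  have h4 : (4 : κ) ≠ 0 := by rw [show (4 : κ) = 2 * 2 by norm_num]; exact mul_ne_zero h2 h2
  rcases mul_eq_zero.mp hq with h0 | h0
  · have h0 := (mul_eq_zero.mp h0).resolve_left h4
    subst h0
    have : p ^ 4 = 0 := by linear_combination hN
    have := pow_eq_zero_iff (by norm_num) |>.mp this
    simp [this] at h₁
  · rw [h0] at hN h
    have : 3 * p ^ 2 + a * q ^ 2 = 0 := by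
      apply pow_eq_zero_iff (two_ne_zero) |>.mp; linear_combination hN
    simp [this] at h

/-- Doubling a point of `y² = x³ + a x + b` that is not singular gives a point that is not
singular. -/
theorem doubling_nonsingular {κ : Type*} [Field κ] (h2 : (2 : κ) ≠ 0) {a b p q n d : κ} (h₁ : p ≠ 0 ∨ q ≠ 0)
    (h : p ^ 3 + a * p * q ^ 2 + b * q ^ 3 ≠ 0 ∨ 3 * p ^ 2 + a * q ^ 2 ≠ 0)
    (hn : n = (3 * p ^ 2 + a * q ^ 2) ^ 2 - 8 * p * (p ^ 3 + a * p * q ^ 2 + b * q ^ 3))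
    (hd : d = 4 * q * (p ^ 3 + a * p * q ^ 2 + b * q ^ 3)) :
    n ^ 3 + a * n * d ^ 2 + b * d ^ 3 ≠ 0 ∨ 3 * n ^ 2 + a * d ^ 2 ≠ 0 := by
  by_contra! H
  obtain ⟨H3, H2⟩ := H
  have h0 := doubling_ne_zero h2 h₁ h
  rw [← hn, ← hd] at h0
  by_cases hd0 : d = 0
  · rw [hd0] at H3 h0
    have : n ^ 3 = 0 := by linear_combination H3
    simp_all
  obtain ⟨e, rfl⟩ : ∃ e, n = e * d := ⟨n / d, by field_simp⟩
  obtain rfl : a = -3 * e ^ 2 := by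
    apply mul_right_cancel₀ (pow_ne_zero 2 hd0); linear_combination H2
  obtain rfl : b = 2 * e ^ 3 := by
    apply mul_right_cancel₀ (pow_ne_zero 3 hd0); linear_combination H3
  -- Now the cubic is `(x - e)² (x + 2e)`, for which `n - e d = (p - e q)⁴`: only the singular point
  -- doubles to the singular point.
  have : (p - e * q) ^ 4 = 0 := by
    rw [hd] at hn; linear_combination -hn
  have : p - e * q = 0 := pow_eq_zero_iff (by norm_num) |>.mp this
  obtain rfl : p = e * q := by linear_combination this
  rcases h with h | h <;> apply h <;> ring

theorem exists_sq_eq_of_double {K : Type*} [Field K] (h2 : (2 : K) ≠ 0) {a b x y : K}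
    (hy0 : y ≠ 0) (hy : y ^ 2 = x ^ 3 + a * x + b) :
    ∃ z, z ^ 2 = ((x ^ 4 - 2 * a * x ^ 2 - 8 * b * x + a ^ 2) / (2 * y) ^ 2) ^ 3 +
      a * ((x ^ 4 - 2 * a * x ^ 2 - 8 * b * x + a ^ 2) / (2 * y) ^ 2) + b := by
  -- The ordinate given by the duplication formula.
  refine ⟨(x ^ 6 + 5 * a * x ^ 4 + 20 * b * x ^ 3 - 5 * a ^ 2 * x ^ 2
    - 4 * a * b * x - 8 * b ^ 2 - a ^ 3) / (2 * y) ^ 3, ?_⟩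
  obtain rfl : b = y ^ 2 - x ^ 3 - a * x := by rw [hy]; ring
  field_simp
  ring

variable {k : Type*} [Field k]

/-- `p / q` is the abscissa of a point of `y² = x³ + A x + B` over `k(t)` which is nowhere singular
and has a pole of large order at infinity. -/
structure IsAdmissible (A B p q : k[X]) : Prop where
  denom_ne_zero : q ≠ 0
  coprime : IsCoprime p q
  nonsingular : IsCoprime (p ^ 3 + A * p * q ^ 2 + B * q ^ 3) (3 * p ^ 2 + A * q ^ 2)
  degree : q.natDegree + 5 ≤ p.natDegree
  square : ∃ y : RatFunc k, y ^ 2 =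
    (algebraMap k[X] (RatFunc k) p / algebraMap k[X] (RatFunc k) q) ^ 3 +
      algebraMap k[X] (RatFunc k) A *
        (algebraMap k[X] (RatFunc k) p / algebraMap k[X] (RatFunc k) q) +
      algebraMap k[X] (RatFunc k) B

theorem natDegree_monomial_le {A p q : k[X]} {i j l n : ℕ} (hA : A.natDegree ≤ n)
    (c : k) : (C c * A ^ l * p ^ i * q ^ j).natDegree ≤
      l * n + i * p.natDegree + j * q.natDegree := by
  refine natDegree_mul_le.trans (add_le_add (natDegree_mul_le.trans (add_le_add
    ((natDegree_C_mul_le _ _).trans ?_) natDegree_pow_le)) natDegree_pow_le)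
  exact natDegree_pow_le.trans (Nat.mul_le_mul_left _ hA)

/-- The duplication formula applied to `p / q` stays in lowest terms because the point is nowhere
singular. A gap of five between the degrees makes `p⁴` dominate the terms with `A` and `B`, of
degrees at most `8` and `12`; the new gap equals the old one, since `4 deg p - (deg q + 3 deg p) =
deg p - deg q`. -/
theorem IsAdmissible.double (h2 : (2 : k) ≠ 0) {A B p q : k[X]}
    (hA : A.natDegree ≤ 8) (hB : B.natDegree ≤ 12) (h : IsAdmissible A B p q) :
    ∃ p' q', IsAdmissible A B p' q' ∧ p'.natDegree = 4 * p.natDegree := by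
  obtain ⟨hq, hpq, hns, hdeg, y, hy⟩ := h
  have h2' : (2 : AlgebraicClosure k) ≠ 0 := by
    rw [← map_ofNat (algebraMap k (AlgebraicClosure k)) 2]
    exact (_root_.map_ne_zero _).mpr h2
  set F := p ^ 3 + A * p * q ^ 2 + B * q ^ 3 with hF
  set N := (3 * p ^ 2 + A * q ^ 2) ^ 2 - 8 * p * F with hN
  have dF : F.natDegree = 3 * p.natDegree := by
    have : F = p ^ 3 + (C 1 * A ^ 1 * p ^ 1 * q ^ 2 + C 1 * B ^ 1 * p ^ 0 * q ^ 3) := by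
      rw [hF]; simp; ring
    rw [this, natDegree_add_eq_left_of_natDegree_lt, natDegree_pow]
    rw [natDegree_pow]
    refine lt_of_le_of_lt (natDegree_add_le _ _) (max_lt ?_ ?_)
    · exact lt_of_le_of_lt (natDegree_monomial_le hA _) (by omega)
    · exact lt_of_le_of_lt (natDegree_monomial_le hB _) (by omega)
  have dN : N.natDegree = 4 * p.natDegree := by
    have : N = p ^ 4 + (C (-2) * A ^ 1 * p ^ 2 * q ^ 2 + C (-8) * B ^ 1 * p ^ 1 * q ^ 3
        + C 1 * A ^ 2 * p ^ 0 * q ^ 4) := by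
      rw [hN, hF]; simp only [C_neg, C_ofNat, C_1]; ring
    rw [this, natDegree_add_eq_left_of_natDegree_lt, natDegree_pow]
    rw [natDegree_pow]
    refine lt_of_le_of_lt (natDegree_add_le _ _) (max_lt
      (lt_of_le_of_lt (natDegree_add_le _ _) (max_lt ?_ ?_)) ?_)
    · exact lt_of_le_of_lt (natDegree_monomial_le hA _) (by omega)
    · exact lt_of_le_of_lt (natDegree_monomial_le hB _) (by omega)
    · exact lt_of_le_of_lt (natDegree_monomial_le hA _) (by omega)
  have hF0 : F ≠ 0 := by rintro h; rw [h, natDegree_zero] at dF; omega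
  have h4 : (4 : k[X]) ≠ 0 := by
    rw [show (4 : k[X]) = C (2 * 2) by rw [C_mul, C_ofNat]; norm_num]
    exact C_ne_zero.mpr (mul_ne_zero h2 h2)
  -- Coprimality of polynomials is tested at each point of the algebraic closure, which reduces the
  -- claims to the two pointwise doubling lemmas.
  have hpt := (isCoprime_iff_aeval_ne_zero_of_isAlgClosed k (AlgebraicClosure k) p q).mp hpq
  have hpt' := (isCoprime_iff_aeval_ne_zero_of_isAlgClosed k (AlgebraicClosure k) _ _).mp hns
  refine ⟨N, 4 * q * F, ⟨mul_ne_zero (mul_ne_zero h4 hq) hF0, ?_, ?_, ?_, ?_⟩, dN⟩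
  · rw [isCoprime_iff_aeval_ne_zero_of_isAlgClosed k (AlgebraicClosure k)]
    intro r
    have := doubling_ne_zero h2' (a := aeval r A) (b := aeval r B) (hpt r)
      (by simpa [hF, map_ofNat] using hpt' r)
    simpa [hN, hF, map_ofNat] using this
  · rw [isCoprime_iff_aeval_ne_zero_of_isAlgClosed k (AlgebraicClosure k)]
    intro r
    have := doubling_nonsingular h2' (a := aeval r A) (b := aeval r B) (hpt r)
      (by simpa [hF, map_ofNat] using hpt' r) (n := aeval r N) (d := aeval r (4 * q * F))
      (by simp [hN, hF, map_ofNat]) (by simp [hF, map_ofNat])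
    simpa [map_ofNat] using this
  · rw [natDegree_mul (mul_ne_zero h4 hq) hF0, natDegree_mul h4 hq, dF, dN]
    rw [show (4 : k[X]) = C 4 by rw [C_ofNat], natDegree_C]
    omega
  · set ι := algebraMap k[X] (RatFunc k)
    have hι : Function.Injective ι := IsFractionRing.injective k[X] (RatFunc k)
    have hQ : ι q ≠ 0 := (map_ne_zero_iff ι hι).mpr hq
    have hF1 : ι F ≠ 0 := (map_ne_zero_iff ι hι).mpr hF0
    have h2K : (2 : RatFunc k) ≠ 0 := by
      rw [← map_ofNat RatFunc.C 2]; exact (_root_.map_ne_zero _).mpr h2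
    have hyF : y ^ 2 * ι q ^ 3 = ι F := by
      rw [hy, hF]; simp only [map_add, map_mul, map_pow]; field_simp
    have hy0 : y ≠ 0 := by rintro rfl; apply hF1; rw [← hyF]; ring
    have hFe : ι F = ι p ^ 3 + ι A * ι p * ι q ^ 2 + ι B * ι q ^ 3 := by
      rw [hF]; simp only [map_add, map_mul, map_pow]
    set x := ι p / ι q
    have hp : ι p = x * ι q := by simp only [x]; field_simp
    have hNd : ι N / ι (4 * q * F) = (x ^ 4 - 2 * ι A * x ^ 2 - 8 * ι B * x + ι A ^ 2) /
        (2 * y) ^ 2 := by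
      have : ι N = (3 * ι p ^ 2 + ι A * ι q ^ 2) ^ 2 - 8 * ι p * ι F := by
        rw [hN]; simp only [map_add, map_mul, map_pow, map_sub, map_ofNat]
      rw [this, map_mul, map_mul, map_ofNat, hFe, hp]
      rw [hFe, hp] at hyF
      have h4K : (4 : RatFunc k) ≠ 0 := by
        rw [show (4 : RatFunc k) = 2 * 2 by norm_num]; exact mul_ne_zero h2K h2K
      rw [hFe, hp] at hF1
      rw [div_eq_div_iff (mul_ne_zero (mul_ne_zero h4K hQ) hF1)
        (pow_ne_zero 2 (mul_ne_zero h2K hy0))]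
      linear_combination (4 * ι q * (x ^ 4 - 2 * ι A * x ^ 2 - 8 * ι B * x + ι A ^ 2)) * hyF
    rw [hNd]
    exact exists_sq_eq_of_double h2K hy0 hy

/-- Repeated doubling makes the degree of the numerator unbounded. -/
theorem infinite_setOf_square (h2 : (2 : k) ≠ 0) {A B p q : k[X]}
    (hA : A.natDegree ≤ 8) (hB : B.natDegree ≤ 12) (h : IsAdmissible A B p q) :
    {x : RatFunc k | ∃ y, y ^ 2 = x ^ 3 + algebraMap k[X] (RatFunc k) A * x +
      algebraMap k[X] (RatFunc k) B}.Infinite := by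
  intro hfin
  obtain ⟨M, hM⟩ := (hfin.image fun x => x.num.natDegree).bddAbove
  have key : ∀ n : ℕ, ∃ p' q', IsAdmissible A B p' q' ∧ n ≤ p'.natDegree := by
    intro n
    induction n with
    | zero => exact ⟨p, q, h, Nat.zero_le _⟩
    | succ n ih =>
      obtain ⟨p', q', h', hn⟩ := ih
      obtain ⟨p'', q'', h'', hd⟩ := h'.double h2 hA hB
      exact ⟨p'', q'', h'', by have := h'.degree; omega⟩
  obtain ⟨p', q', h', hn⟩ := key (M + 1)
  have hm := hM ⟨_, h'.square, rfl⟩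
  set x := algebraMap k[X] (RatFunc k) p' / algebraMap k[X] (RatFunc k) q' with hx
  have hι : Function.Injective (algebraMap k[X] (RatFunc k)) :=
    IsFractionRing.injective k[X] (RatFunc k)
  have hq : algebraMap k[X] (RatFunc k) q' ≠ 0 := (map_ne_zero_iff _ hι).mpr h'.denom_ne_zero
  have e : p' * x.denom = x.num * q' := by
    apply hι
    have hd : algebraMap k[X] (RatFunc k) x.denom ≠ 0 :=
      (map_ne_zero_iff _ hι).mpr x.denom_ne_zero
    rw [map_mul, map_mul, ← div_eq_div_iff hq hd, ← hx, RatFunc.num_div_denom]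
  -- Only divisibility is needed: it bounds the degree of `p'` by that of the normalized numerator.
  have hdvd : p' ∣ x.num := h'.coprime.dvd_of_dvd_mul_right (Dvd.intro _ e)
  have hp0 : x.num ≠ 0 := by
    intro h0
    rw [h0, zero_mul] at e
    rcases mul_eq_zero.mp e with h0 | h0
    · rw [h0] at hn; simp at hn
    · exact x.denom_ne_zero h0
  have := natDegree_le_of_dvd hdvd hp0
  simp only at hm
  omega

end Doubling

/-! ### The genus one curve `w² = -3 lineDisc a b t c` over `k(t)` and its infinitely many points -/

section Quartic

open Polynomial

/-- The discriminant of `X³ - t² X² + (a - 2 t c) X + b - c²`, the polynomial of the abscissas of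
the intersection points of `y² = x³ + a x + b` with the line `y = t x + c`. -/
def lineDisc {A : Type*} [CommRing A] (a b t c : A) : A :=
  -27 * c ^ 4 - 4 * t ^ 3 * c ^ 3 + (54 * b - 30 * a * t ^ 2) * c ^ 2 +
    (-4 * a * t ^ 5 + 36 * b * t ^ 3 + 24 * a ^ 2 * t) * c +
    (4 * b * t ^ 6 + a ^ 2 * t ^ 4 - 18 * a * b * t ^ 2 - 4 * a ^ 3 - 27 * b ^ 2)

variable {k : Type*} [Field k]

/-- The coefficient of `x` in the Weierstrass equation of `w² = -3 lineDisc a b t c`. -/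
noncomputable def jacA (a b : k) : k[X] :=
  C (144 * a) * X ^ 8 + C (2592 * b) * X ^ 6 + C (-2592 * a ^ 2) * X ^ 4 +
    C (-7776 * a * b) * X ^ 2 + C (-3888 * a ^ 3 - 34992 * b ^ 2)

/-- The constant coefficient in the Weierstrass equation of `w² = -3 lineDisc a b t c`. -/
noncomputable def jacB (a b : k) : k[X] :=
  C (-1728 * b) * X ^ 12 + C (6912 * a ^ 2) * X ^ 10 + C (77760 * a * b) * X ^ 8 +
    C (466560 * b ^ 2) * X ^ 6 + C (-233280 * a ^ 2 * b) * X ^ 4 +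
    C (839808 * a * b ^ 2 + 186624 * a ^ 4) * X ^ 2 + C (2519424 * b ^ 3 + 419904 * a ^ 3 * b)

theorem natDegree_jacA (a b : k) : (jacA a b).natDegree ≤ 8 := by
  unfold jacA; compute_degree!

theorem natDegree_jacB (a b : k) : (jacB a b).natDegree ≤ 12 := by
  unfold jacB; compute_degree!

theorem algebraMap_jacA (a b : k) : algebraMap k[X] (RatFunc k) (jacA a b) =
    144 * RatFunc.C a * RatFunc.X ^ 8 + 2592 * RatFunc.C b * RatFunc.X ^ 6
      - 2592 * RatFunc.C a ^ 2 * RatFunc.X ^ 4 - 7776 * RatFunc.C a * RatFunc.C b * RatFunc.X ^ 2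
      - 3888 * RatFunc.C a ^ 3 - 34992 * RatFunc.C b ^ 2 := by
  simp only [jacA, map_add, map_mul, map_pow, RatFunc.algebraMap_C, RatFunc.algebraMap_X, map_sub,
    map_neg, map_ofNat]
  ring

theorem algebraMap_jacB (a b : k) : algebraMap k[X] (RatFunc k) (jacB a b) =
    -1728 * RatFunc.C b * RatFunc.X ^ 12 + 6912 * RatFunc.C a ^ 2 * RatFunc.X ^ 10
      + 77760 * RatFunc.C a * RatFunc.C b * RatFunc.X ^ 8 + 466560 * RatFunc.C b ^ 2 * RatFunc.X ^ 6
      - 233280 * RatFunc.C a ^ 2 * RatFunc.C b * RatFunc.X ^ 4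
      + (839808 * RatFunc.C a * RatFunc.C b ^ 2 + 186624 * RatFunc.C a ^ 4) * RatFunc.X ^ 2
      + 2519424 * RatFunc.C b ^ 3 + 419904 * RatFunc.C a ^ 3 * RatFunc.C b := by
  simp only [jacB, map_add, map_mul, map_pow, RatFunc.algebraMap_C, RatFunc.algebraMap_X,
    map_neg, map_ofNat]
  ring

theorem natCast_ne_zero_of_two_three {K : Type*} [Field K] (h2 : (2 : K) ≠ 0) (h3 : (3 : K) ≠ 0)
    (i j : ℕ) : (2 ^ i * 3 ^ j : K) ≠ 0 := mul_ne_zero (pow_ne_zero _ h2) (pow_ne_zero _ h3)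

theorem aeval_jacA {A : Type*} [CommRing A] [Algebra k A] (a b : k) (r : A) :
    aeval r (jacA a b) = 144 * algebraMap k A a * r ^ 8 + 2592 * algebraMap k A b * r ^ 6
      - 2592 * algebraMap k A a ^ 2 * r ^ 4 - 7776 * algebraMap k A a * algebraMap k A b * r ^ 2
      - 3888 * algebraMap k A a ^ 3 - 34992 * algebraMap k A b ^ 2 := by
  simp only [jacA, map_add, map_mul, map_pow, aeval_C, aeval_X, map_sub, map_neg, map_ofNat]
  ring

theorem aeval_jacB {A : Type*} [CommRing A] [Algebra k A] (a b : k) (r : A) :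
    aeval r (jacB a b) = -1728 * algebraMap k A b * r ^ 12 + 6912 * algebraMap k A a ^ 2 * r ^ 10
      + 77760 * algebraMap k A a * algebraMap k A b * r ^ 8 + 466560 * algebraMap k A b ^ 2 * r ^ 6
      - 233280 * algebraMap k A a ^ 2 * algebraMap k A b * r ^ 4
      + (839808 * algebraMap k A a * algebraMap k A b ^ 2 + 186624 * algebraMap k A a ^ 4) * r ^ 2
      + 2519424 * algebraMap k A b ^ 3 + 419904 * algebraMap k A a ^ 3 * algebraMap k A b := by
  simp only [jacB, map_add, map_mul, map_pow, aeval_C, aeval_X, map_neg, map_ofNat]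
  ring

/-- If `a ≠ 0`, the difference of the two points at infinity of `w² = -3 lineDisc a b t c` is
nowhere singular. -/
theorem isAdmissible_of_ne_zero (h2 : (2 : k) ≠ 0) (h3 : (3 : k) ≠ 0) {a b : k} (ha : a ≠ 0)
    (hd : 4 * a ^ 3 + 27 * b ^ 2 ≠ 0) :
    IsAdmissible (jacA a b) (jacB a b)
      (C (4 / 9) * X ^ 6 + C (-60 * a) * X ^ 2 + C (108 * b)) 1 := by
  have h9 : (9 : k) ≠ 0 := by have := natCast_ne_zero_of_two_three h2 h3 0 2; norm_num at this; exact this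
  have h4 : (4 : k) ≠ 0 := by have := natCast_ne_zero_of_two_three h2 h3 2 0; norm_num at this; exact this
  refine ⟨one_ne_zero, isCoprime_one_right, ?_, ?_, ?_⟩
  · rw [isCoprime_iff_aeval_ne_zero_of_isAlgClosed k (AlgebraicClosure k)]
    intro r
    by_contra! H
    obtain ⟨H1, H2⟩ := H
    simp only [map_add, map_mul, map_pow, aeval_jacA, aeval_jacB, aeval_C, aeval_X, map_ofNat,
      map_one, map_div₀, map_neg] at H1 H2
    set ι := algebraMap k (AlgebraicClosure k)
    have h2' : (2 : AlgebraicClosure k) ≠ 0 := by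
      rw [← map_ofNat ι 2]; exact (_root_.map_ne_zero _).mpr h2
    have h3' : (3 : AlgebraicClosure k) ≠ 0 := by
      rw [← map_ofNat ι 3]; exact (_root_.map_ne_zero _).mpr h3
    have ha' : ι a ≠ 0 := (_root_.map_ne_zero _).mpr ha
    have hd' : 4 * ι a ^ 3 + 27 * ι b ^ 2 ≠ 0 := by
      have := (_root_.map_ne_zero ι).mpr hd
      simpa only [map_add, map_mul, map_pow, map_ofNat] using this
    generalize ι a = a at *
    generalize ι b = b at *
    clear_value ι
    have hK : ∀ i j : ℕ, (2 ^ i * 3 ^ j : AlgebraicClosure k) ≠ 0 :=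
      natCast_ne_zero_of_two_three h2' h3'
    have h9' : (9 : AlgebraicClosure k) ≠ 0 := by convert hK 0 2 using 1; norm_num
    -- the ordinate vanishes
    have E1 : (r * (r ^ 8 + 162 * a * r ^ 4 - 2916 * b * r ^ 2 - 2187 * a ^ 2)) ^ 2 = 0 := by
      apply (mul_eq_zero.mp (?_ : (2 ^ 6 * 3 ^ 0 : AlgebraicClosure k) * _ = 0)).resolve_left (hK 6 0)
      field_simp at H1
      linear_combination H1
    have E1 := pow_eq_zero_iff two_ne_zero |>.mp E1
    have E2 : r ^ 12 - 27 * a * r ^ 8 + 4860 * b * r ^ 6 + 13851 * a ^ 2 * r ^ 4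
        - 78732 * a * b * r ^ 2 - 6561 * a ^ 3 = 0 := by
      apply (mul_eq_zero.mp (?_ : (2 ^ 4 * 3 ^ 1 : AlgebraicClosure k) * _ = 0)).resolve_left (hK 4 1)
      field_simp at H2
      linear_combination H2
    rcases mul_eq_zero.mp E1 with hr | E1
    · rw [hr] at E2
      apply mul_ne_zero (hK 0 8) (pow_ne_zero 3 ha')
      linear_combination -E2
    -- This substitution turns the octic factor of the ordinate into `3⁷` times the 3-division
    -- polynomial of `y² = x³ + ax + b`.
    obtain ⟨x, hx⟩ : ∃ x, r ^ 2 = -9 * x := ⟨-r ^ 2 / 9, by field_simp⟩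
    have p4 : r ^ 4 = 81 * x ^ 2 := by linear_combination (r ^ 2 - 9 * x) * hx
    have p6 : r ^ 6 = -729 * x ^ 3 := by linear_combination r ^ 4 * hx - 9 * x * p4
    have p8 : r ^ 8 = 6561 * x ^ 4 := by linear_combination (r ^ 4 + 81 * x ^ 2) * p4
    have p12 : r ^ 12 = 531441 * x ^ 6 := by linear_combination (r ^ 6 - 729 * x ^ 3) * p6
    rw [p8, p4, hx] at E1
    rw [p12, p8, p6, p4, hx] at E2
    have hψ : 3 * x ^ 4 + 6 * a * x ^ 2 + 12 * b * x - a ^ 2 = 0 := by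
      apply (mul_eq_zero.mp (?_ : (2 ^ 0 * 3 ^ 7 : AlgebraicClosure k) * _ = 0)).resolve_left (hK 0 7)
      linear_combination E1
    have hx0 : x ≠ 0 := by
      rintro rfl
      apply ha'
      apply pow_eq_zero_iff two_ne_zero |>.mp
      linear_combination -hψ
    -- `E2` reduced modulo the division polynomial. A combination of the two is `(3x² + a)³`, which
    -- forces the original cubic to have a double root.
    have hk : 27 * b * x ^ 3 - 18 * a ^ 2 * x ^ 2 - 27 * a * b * x + 2 * a ^ 3 = 0 := by
      apply (mul_eq_zero.mp (?_ : (2 ^ 5 * 3 ^ 8 : AlgebraicClosure k) * _ = 0)).resolve_left (hK 5 8)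
      linear_combination -E2 + 3 ^ 6 * (9 * x ^ 2 - 21 * a) * 27 * hψ
    have hc : (3 * x ^ 2 + a) ^ 3 = 0 := by
      linear_combination (9 * x ^ 2 - 9 * a) * hψ - 4 * hk
    have hc := pow_eq_zero_iff (three_ne_zero) |>.mp hc
    obtain rfl : a = -3 * x ^ 2 := by linear_combination hc
    have hb : b = 2 * x ^ 3 := by
      have h12 : (12 * x : AlgebraicClosure k) ≠ 0 := mul_ne_zero (by convert hK 2 1 using 1; norm_num) hx0
      apply mul_left_cancel₀ h12
      linear_combination hψ
    apply hd'
    rw [hb]; ring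
  · have : (C (4 / 9 : k) * X ^ 6 + C (-60 * a) * X ^ 2 + C (108 * b)).natDegree = 6 := by
      compute_degree!
    rw [this]; simp
  · refine ⟨8 / 27 * RatFunc.X ^ 9 + 48 * RatFunc.C a * RatFunc.X ^ 5
      - 864 * RatFunc.C b * RatFunc.X ^ 3 - 648 * RatFunc.C a ^ 2 * RatFunc.X, ?_⟩
    have h3K : (3 : RatFunc k) ≠ 0 := by
      rw [← map_ofNat RatFunc.C 3]; exact (_root_.map_ne_zero _).mpr h3
    have h9K : (9 : RatFunc k) ≠ 0 := by
      rw [show (9 : RatFunc k) = 3 * 3 by norm_num]; exact mul_ne_zero h3K h3K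
    have h27K : (27 : RatFunc k) ≠ 0 := by
      rw [show (27 : RatFunc k) = 3 * 9 by norm_num]; exact mul_ne_zero h3K h9K
    rw [algebraMap_jacA, algebraMap_jacB]
    simp only [map_add, map_mul, map_pow, RatFunc.algebraMap_C, RatFunc.algebraMap_X,
      map_neg, map_ofNat, map_one, map_div₀, div_one]
    field_simp
    ring

/-- Here `M` stands for `t⁶`. The point with abscissa `(4M + 972b) / 9` is singular at `M = 0` only.
In its double, numerator and denominator share the factor `2⁸ · 9 · M`; after its removal, `M = 0`
is checked directly and `M ≠ 0` follows from the doubling lemmas. -/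
theorem nonsingular_of_eq_zero {κ : Type*} [Field κ] (h2 : (2 : κ) ≠ 0) (h3 : (3 : κ) ≠ 0)
    {b M p q A B : κ} (hb : b ≠ 0) (hA : A = 2592 * b * M - 34992 * b ^ 2)
    (hB : B = -1728 * b * M ^ 2 + 466560 * b ^ 2 * M + 2519424 * b ^ 3)
    (hp : 9 * p = 9 * M * (M + 4860 * b) ^ 2 - (8 * M + 1944 * b) * (M - 2916 * b) ^ 2)
    (hq : q = (M - 2916 * b) ^ 2) :
    (p ≠ 0 ∨ q ≠ 0) ∧
      (p ^ 3 + A * p * q ^ 2 + B * q ^ 3 ≠ 0 ∨ 3 * p ^ 2 + A * q ^ 2 ≠ 0) := by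
  have hK : ∀ i j : ℕ, (2 ^ i * 3 ^ j : κ) ≠ 0 := natCast_ne_zero_of_two_three h2 h3
  have h9 : (9 : κ) ≠ 0 := by convert hK 0 2 using 1; norm_num
  have hbn : ∀ i j n : ℕ, (2 ^ i * 3 ^ j : κ) * b ^ n ≠ 0 := fun i j n =>
    mul_ne_zero (hK i j) (pow_ne_zero n hb)
  by_cases hM : M = 0
  · obtain rfl : p = -216 * b * q := by
      apply mul_left_cancel₀ h9; rw [hp, hq, hM]; ring
    have hq0 : q ≠ 0 := by
      rw [hq, hM]; intro h; apply hbn 4 12 2; linear_combination h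
    refine ⟨Or.inr hq0, Or.inr ?_⟩
    rw [hA, hM]
    intro h
    apply mul_ne_zero (hbn 4 8 2) (pow_ne_zero 2 hq0)
    linear_combination h
  · set x := 4 * M + 972 * b with hx
    have e1 : x ^ 3 + A * x * 9 ^ 2 + B * 9 ^ 3 = 2 ^ 6 * 3 ^ 0 * (M * (M - 2916 * b) ^ 2) := by
      rw [hx, hA, hB]; ring
    have e2 : 3 * x ^ 2 + A * 9 ^ 2 = 2 ^ 4 * 3 ^ 1 * (M * (M + 4860 * b)) := by
      rw [hx, hA]; ring
    have ns : x ^ 3 + A * x * 9 ^ 2 + B * 9 ^ 3 ≠ 0 ∨ 3 * x ^ 2 + A * 9 ^ 2 ≠ 0 := by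
      rw [e1, e2]
      by_contra! H
      obtain ⟨H1, H2⟩ := H
      have H1 := (mul_eq_zero.mp ((mul_eq_zero.mp H1).resolve_left (hK 6 0))).resolve_left hM
      have H2 := (mul_eq_zero.mp ((mul_eq_zero.mp H2).resolve_left (hK 4 1))).resolve_left hM
      have H1 := pow_eq_zero_iff two_ne_zero |>.mp H1
      apply hbn 5 5 1
      linear_combination H2 - H1
    have hc : (2 ^ 8 * 3 ^ 2 * M : κ) ≠ 0 := mul_ne_zero (hK 8 2) hM
    have d0 := doubling_ne_zero h2 (Or.inr h9) ns
    have d1 := doubling_nonsingular h2 (Or.inr h9) ns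
      (n := 2 ^ 8 * 3 ^ 2 * M * p) (d := 2 ^ 8 * 3 ^ 2 * M * q)
      (by rw [e1, e2, hx]; linear_combination 2 ^ 8 * M * hp)
      (by rw [e1, hq]; ring)
    rw [e1, e2] at d0
    constructor
    · by_contra! H
      obtain ⟨rfl, rfl⟩ := H
      rcases d0 with h | h <;> apply h
      · rw [hx]; linear_combination - 2 ^ 8 * M * hp
      · linear_combination -(2 ^ 8 * 3 ^ 2 * M) * hq
    · by_contra! H
      obtain ⟨H1, H2⟩ := H
      rcases d1 with h | h <;> apply h
      · linear_combination (2 ^ 8 * 3 ^ 2 * M) ^ 3 * H1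
      · linear_combination (2 ^ 8 * 3 ^ 2 * M) ^ 2 * H2

/-- If `a = 0`, twice the difference of the two points at infinity of `w² = -3 lineDisc 0 b t c` is
nowhere singular. -/
theorem isAdmissible_of_eq_zero (h2 : (2 : k) ≠ 0) (h3 : (3 : k) ≠ 0) {b : k} (hb : b ≠ 0) :
    IsAdmissible (jacA 0 b) (jacB 0 b)
      (C (1 / 9) * X ^ 18 + C (14688 * b) * X ^ 12 + C (17321040 * b ^ 2) * X ^ 6
        - C (1836660096 * b ^ 3)) ((X ^ 6 - C (2916 * b)) ^ 2) := by
  have h9 : (9 : k) ≠ 0 := by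
    have := natCast_ne_zero_of_two_three h2 h3 0 2; norm_num at this; exact this
  have hdeg : (X ^ 6 - C (2916 * b) : k[X]).natDegree = 6 := by compute_degree!
  have hpt := fun r : AlgebraicClosure k => nonsingular_of_eq_zero
    (κ := AlgebraicClosure k) (M := r ^ 6) (b := algebraMap k _ b)
    (p := aeval r (C (1 / 9) * X ^ 18 + C (14688 * b) * X ^ 12 + C (17321040 * b ^ 2) * X ^ 6
      - C (1836660096 * b ^ 3)))
    (q := aeval r ((X ^ 6 - C (2916 * b)) ^ 2))
    (A := aeval r (jacA 0 b)) (B := aeval r (jacB 0 b))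
    (by rw [← map_ofNat (algebraMap k _) 2]; exact (_root_.map_ne_zero _).mpr h2)
    (by rw [← map_ofNat (algebraMap k _) 3]; exact (_root_.map_ne_zero _).mpr h3)
    ((_root_.map_ne_zero _).mpr hb)
    (by rw [aeval_jacA, map_zero]; ring)
    (by rw [aeval_jacB, map_zero]; ring)
    (by
      have h9' : (9 : AlgebraicClosure k) ≠ 0 := by
        rw [← map_ofNat (algebraMap k _) 9]; exact (_root_.map_ne_zero _).mpr h9
      simp only [map_add, map_mul, map_pow, aeval_C, aeval_X, map_sub, map_ofNat, map_one,
        map_div₀]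
      field_simp
      ring)
    (by simp only [map_mul, map_pow, aeval_C, aeval_X, map_sub, map_ofNat])
  have h2K : (2 : RatFunc k) ≠ 0 := by
    rw [← map_ofNat RatFunc.C 2]; exact (_root_.map_ne_zero _).mpr h2
  have h3K : (3 : RatFunc k) ≠ 0 := by
    rw [← map_ofNat RatFunc.C 3]; exact (_root_.map_ne_zero _).mpr h3
  have h9K : (9 : RatFunc k) ≠ 0 := by
    rw [show (9 : RatFunc k) = 3 * 3 by norm_num]; exact mul_ne_zero h3K h3K
  have h27K : (27 : RatFunc k) ≠ 0 := by
    rw [show (27 : RatFunc k) = 3 * 9 by norm_num]; exact mul_ne_zero h3K h9K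
  have hq0 : (X ^ 6 - C (2916 * b) : k[X]) ≠ 0 := fun h => by
    rw [h, natDegree_zero] at hdeg; omega
  refine ⟨pow_ne_zero 2 hq0, ?_, ?_, ?_, ?_⟩
  · rw [isCoprime_iff_aeval_ne_zero_of_isAlgClosed k (AlgebraicClosure k)]
    exact fun r => (hpt r).1
  · rw [isCoprime_iff_aeval_ne_zero_of_isAlgClosed k (AlgebraicClosure k)]
    exact fun r => by simpa only [map_add, map_mul, map_pow, map_ofNat] using (hpt r).2
  · rw [natDegree_pow, hdeg]
    have : (C (1 / 9) * X ^ 18 + C (14688 * b) * X ^ 12 + C (17321040 * b ^ 2) * X ^ 6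
        - C (1836660096 * b ^ 3)).natDegree = 18 := by compute_degree!
    rw [this]; norm_num
  · have hQ : (RatFunc.X ^ 6 - 2916 * RatFunc.C b : RatFunc k) ≠ 0 := by
      have := (map_ne_zero_iff (algebraMap k[X] (RatFunc k))
        (IsFractionRing.injective k[X] (RatFunc k))).mpr hq0
      simpa only [map_sub, map_pow, map_mul, RatFunc.algebraMap_X, RatFunc.algebraMap_C,
        map_ofNat] using this
    have hX : (RatFunc.X : RatFunc k) ≠ 0 := RatFunc.X_ne_zero
    have h8K : (8 : RatFunc k) ≠ 0 := by
      rw [show (8 : RatFunc k) = 2 ^ 3 by norm_num]; exact pow_ne_zero 3 h2K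
    have hy0 : 8 / 27 * RatFunc.X ^ 3 * (RatFunc.X ^ 6 - 2916 * RatFunc.C b : RatFunc k) ≠ 0 :=
      mul_ne_zero (mul_ne_zero (div_ne_zero h8K h27K) (pow_ne_zero 3 hX)) hQ
    -- The point being doubled is the one used for `a ≠ 0`, specialized to `a = 0`.
    obtain ⟨z, hz⟩ := exists_sq_eq_of_double h2K
      (x := 4 / 9 * RatFunc.X ^ 6 + 108 * RatFunc.C b)
      (a := algebraMap k[X] (RatFunc k) (jacA 0 b)) (b := algebraMap k[X] (RatFunc k) (jacB 0 b))
      hy0 (by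
        rw [algebraMap_jacA, algebraMap_jacB, map_zero]
        field_simp
        ring)
    have e : ∀ A B u v : RatFunc k, u = v → u ^ 3 + A * u + B = v ^ 3 + A * v + B := by
      rintro A B u v rfl; rfl
    refine ⟨z, hz.trans (e _ _ _ _ ?_)⟩
    rw [map_pow (algebraMap k[X] (RatFunc k)), map_sub (algebraMap k[X] (RatFunc k)) (X ^ 6)]
    simp only [map_add, map_mul, map_pow, map_sub, RatFunc.algebraMap_C, RatFunc.algebraMap_X,
        map_ofNat, map_one, map_div₀, algebraMap_jacA, algebraMap_jacB, map_zero]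
    rw [div_eq_div_iff (pow_ne_zero 2 (mul_ne_zero h2K hy0)) (pow_ne_zero 2 hQ)]
    field_simp
    ring

/-- The points of the Weierstrass model other than those with abscissa `x₀` map to values of `c`,
and each `c` comes from at most two abscissas. So infinitely many abscissas give infinitely many
`c`. -/
theorem infinite_setOf_lineDisc (h2 : (2 : k) ≠ 0) (h3 : (3 : k) ≠ 0) {a b : k}
    (hd : 4 * a ^ 3 + 27 * b ^ 2 ≠ 0) :
    {c : RatFunc k | ∃ w, w ^ 2 = -3 * lineDisc (RatFunc.C a) (RatFunc.C b) RatFunc.X c}.Infinite := by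
  have hE : {x : RatFunc k | ∃ y, y ^ 2 = x ^ 3 + algebraMap k[X] (RatFunc k) (jacA a b) * x +
      algebraMap k[X] (RatFunc k) (jacB a b)}.Infinite := by
    by_cases ha : a = 0
    · subst ha
      have hb : b ≠ 0 := by rintro rfl; simp at hd
      exact infinite_setOf_square h2 (natDegree_jacA _ _) (natDegree_jacB _ _)
        (isAdmissible_of_eq_zero h2 h3 hb)
    · exact infinite_setOf_square h2 (natDegree_jacA _ _) (natDegree_jacB _ _)
        (isAdmissible_of_ne_zero h2 h3 ha hd)
  have h2K : (2 : RatFunc k) ≠ 0 := by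
    rw [← map_ofNat RatFunc.C 2]; exact (_root_.map_ne_zero _).mpr h2
  have h3K : (3 : RatFunc k) ≠ 0 := by
    rw [← map_ofNat RatFunc.C 3]; exact (_root_.map_ne_zero _).mpr h3
  have h9K : (9 : RatFunc k) ≠ 0 := by
    rw [show (9 : RatFunc k) = 3 * 3 by norm_num]; exact mul_ne_zero h3K h3K
  have h18K : (18 : RatFunc k) ≠ 0 := by
    rw [show (18 : RatFunc k) = 2 * 9 by norm_num]; exact mul_ne_zero h2K h9K
  have h81K : (81 : RatFunc k) ≠ 0 := by
    rw [show (81 : RatFunc k) = 9 * 9 by norm_num]; exact mul_ne_zero h9K h9K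
  have h243K : (243 : RatFunc k) ≠ 0 := by
    rw [show (243 : RatFunc k) = 3 * 81 by norm_num]; exact mul_ne_zero h3K h81K
  have h6561K : (6561 : RatFunc k) ≠ 0 := by
    rw [show (6561 : RatFunc k) = 81 * 81 by norm_num]; exact mul_ne_zero h81K h81K
  intro hfin
  set t : RatFunc k := RatFunc.X
  have hA := algebraMap_jacA a b
  have hB := algebraMap_jacB a b
  set a' := RatFunc.C a
  set b' := RatFunc.C b
  set x₀ := 4 / 9 * t ^ 6 - 60 * a' * t ^ 2 + 108 * b' with hx₀
  set β := 2 / 3 * t ^ 3 with hβ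
  set γ := 5 * a' * t ^ 2 - 9 * b' - 2 / 81 * t ^ 6 with hγ
  set δ := 8 / 243 * t ^ 9 + 16 / 3 * a' * t ^ 5 - 96 * b' * t ^ 3 - 72 * a' ^ 2 * t with hδ
  set ε := -4 / 6561 * t ^ 12 + 20 / 81 * a' * t ^ 8 - 112 / 9 * b' * t ^ 6 - 28 * a' ^ 2 * t ^ 4
    + 144 * a' * b' * t ^ 2 + 12 * a' ^ 3 with hε
  -- Completing the square of the quartic in `c`, which leaves the linear remainder `δ c + ε`.
  have hq : ∀ c, -3 * lineDisc a' b' t c = (9 * c ^ 2 + β * c + γ) ^ 2 + (δ * c + ε) := by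
    intro c
    rw [lineDisc, hβ, hγ, hδ, hε]
    field_simp
    ring
  -- With `q = 9c² + βc + γ` and `u = w + q`, the quartic becomes `u² - 2uq = δc + ε`. Multiplied by
  -- `u` and written in `X = u`, `Y = uc`, it is a general Weierstrass equation; scaling by `18` and
  -- completing the square and the cube give the short form. The point `X = Y = 0` has abscissa
  -- `x₀`.
  have hJ : ∀ X Y : RatFunc k, (18 * (18 * Y + β * X + δ / 2)) ^ 2 - ((18 * X + x₀) ^ 3 +
      algebraMap k[X] (RatFunc k) (jacA a b) * (18 * X + x₀) +
      algebraMap k[X] (RatFunc k) (jacB a b)) =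
      18 ^ 3 * (18 * Y ^ 2 + 2 * β * X * Y + δ * Y - (X ^ 3 - 2 * γ * X ^ 2 - ε * X)) := by
    intro X Y
    rw [hA, hB, hβ, hγ, hδ, hε, hx₀]
    field_simp
    ring
  have key : {x : RatFunc k | ∃ y, y ^ 2 = x ^ 3 + algebraMap k[X] (RatFunc k) (jacA a b) * x +
      algebraMap k[X] (RatFunc k) (jacB a b)} ⊆ {x₀} ∪
      ⋃ c ∈ {c : RatFunc k | ∃ w, w ^ 2 = -3 * lineDisc a' b' t c},
        (fun u => 18 * u + x₀) '' {u | (u - (9 * c ^ 2 + β * c + γ)) ^ 2 =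
          -3 * lineDisc a' b' t c} := by
    rintro x ⟨y, hy⟩
    by_cases hx : x = x₀
    · exact Or.inl hx
    right
    obtain ⟨u, rfl⟩ : ∃ u, x = 18 * u + x₀ := ⟨(x - x₀) / 18, by field_simp; ring⟩
    have hu : u ≠ 0 := by rintro rfl; simp at hx
    obtain ⟨c, rfl⟩ : ∃ c, y = 18 * (18 * (u * c) + β * u + δ / 2) :=
      ⟨(y / 18 - β * u - δ / 2) / 18 / u, by field_simp; ring⟩
    have hW := hJ u (u * c)
    rw [hy, sub_self, eq_comm, mul_eq_zero] at hW
    have hW := hW.resolve_left (pow_ne_zero 3 h18K)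
    have hw : (u - (9 * c ^ 2 + β * c + γ)) ^ 2 = -3 * lineDisc a' b' t c := by
      rw [hq]
      apply mul_left_cancel₀ hu
      linear_combination -hW
    simp only [Set.mem_iUnion]
    exact ⟨c, ⟨_, hw⟩, u, hw, rfl⟩
  refine hE (Set.Finite.subset ((Set.finite_singleton _).union (hfin.biUnion ?_)) key)
  rintro c ⟨w, hw⟩
  apply Set.Finite.image
  apply Set.Finite.subset (Set.toFinite {9 * c ^ 2 + β * c + γ + w, 9 * c ^ 2 + β * c + γ - w})
  intro u hu
  rw [Set.mem_ofPred_eq, ← hw] at hu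
  rcases sq_eq_sq_iff_eq_or_eq_neg.mp hu with h | h
  · left; linear_combination h
  · right; rw [Set.mem_singleton_iff]; linear_combination h

end Quartic

/-! ### Linear substitutions and explicit ternary cubics -/

section NormalForm

open MvPolynomial

variable {k : Type*}

/-- The linear substitution `x ↦ N x` in a ternary polynomial. -/
noncomputable def subst [CommRing k] (N : Matrix (Fin 3) (Fin 3) k) :
    MvPolynomial (Fin 3) k →ₐ[k] MvPolynomial (Fin 3) k :=
  aeval fun i => ∑ j, C (N i j) * X j

theorem aeval_subst [CommRing k] {A : Type*} [CommRing A] [Algebra k A]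
    (N : Matrix (Fin 3) (Fin 3) k) (F : MvPolynomial (Fin 3) k) (x : Fin 3 → A) :
    aeval x (subst N F) = aeval (N.map (algebraMap k A) *ᵥ x) F := by
  rw [subst, ← AlgHom.comp_apply, comp_aeval]
  congr 2
  funext i
  simp [Matrix.mulVec, dotProduct]

theorem subst_subst [CommRing k] (M N : Matrix (Fin 3) (Fin 3) k) (F : MvPolynomial (Fin 3) k) :
    subst M (subst N F) = subst (N * M) F := by
  refine (aeval_subst N F fun i => ∑ j, C (M i j) * X j).trans ?_
  have : N.map (algebraMap k (MvPolynomial (Fin 3) k)) *ᵥ (fun i => ∑ j, C (M i j) * X j) =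
      fun i => ∑ j, C ((N * M) i j) * X j := ?_
  · rw [this]; rfl
  funext i
  simp only [Matrix.mulVec, dotProduct, Matrix.map_apply, Matrix.mul_apply, map_sum, map_mul,
    Finset.sum_mul, Finset.mul_sum, algebraMap_eq, mul_assoc]
  rw [Finset.sum_comm]

theorem subst_one [CommRing k] (F : MvPolynomial (Fin 3) k) : subst 1 F = F := by
  rw [subst]
  have : (fun i => ∑ j, C ((1 : Matrix (Fin 3) (Fin 3) k) i j) * X j) = X := by
    funext i
    simp [Matrix.one_apply]
  rw [this, aeval_X_left_apply]

/-- The chain rule; gradients transform by the transpose, as lines do. -/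
theorem gradient_subst [CommRing k] {A : Type*} [CommRing A] [Algebra k A]
    (N : Matrix (Fin 3) (Fin 3) k) (F : MvPolynomial (Fin 3) k) (x : Fin 3 → A) :
    gradient (subst N F) x =
      (N.map (algebraMap k A))ᵀ *ᵥ gradient F (N.map (algebraMap k A) *ᵥ x) := by
  induction F using MvPolynomial.induction_on with
  | C c => funext i; simp [gradient, Matrix.mulVec, dotProduct, subst]
  | add p q hp hq =>
    have : ∀ (p q : MvPolynomial (Fin 3) k) (y : Fin 3 → A),
        gradient (p + q) y = gradient p y + gradient q y := by
      intro p q y; funext i; simp [gradient]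
    rw [map_add, this, this, hp, hq, Matrix.mulVec_add]
  | mul_X p j hp =>
    have : ∀ (p q : MvPolynomial (Fin 3) k) (y : Fin 3 → A),
        gradient (p * q) y = aeval y p • gradient q y + aeval y q • gradient p y := by
      intro p q y; funext i; simp [gradient]
    rw [map_mul, this, this, hp, Matrix.mulVec_add, Matrix.mulVec_smul, Matrix.mulVec_smul,
      aeval_subst, aeval_subst]
    congr 2
    funext i
    simp [gradient, subst, Matrix.mulVec, dotProduct, pderiv_X, Pi.single_apply, Matrix.map_apply,
      apply_ite]

theorem gradient_C_mul [CommRing k] {A : Type*} [CommRing A] [Algebra k A]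
    (c : k) (F : MvPolynomial (Fin 3) k) (x : Fin 3 → A) :
    gradient (C c * F) x = algebraMap k A c • gradient F x := by
  funext i
  simp [gradient]

/-- The Weierstrass form `Y² Z - X³ - a X Z² - b Z³`, in the coordinates `(Y, X, Z)`. -/
noncomputable def weier [CommRing k] (a b : k) : MvPolynomial (Fin 3) k :=
  X 0 ^ 2 * X 2 - X 1 ^ 3 - C a * X 1 * X 2 ^ 2 - C b * X 2 ^ 3

theorem aeval_weier [CommRing k] {A : Type*} [CommRing A] [Algebra k A] (a b : k)
    (x : Fin 3 → A) : aeval x (weier a b) = x 0 ^ 2 * x 2 - x 1 ^ 3 -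
      algebraMap k A a * x 1 * x 2 ^ 2 - algebraMap k A b * x 2 ^ 3 := by
  simp [weier]

theorem gradient_weier [CommRing k] {A : Type*} [CommRing A] [Algebra k A] (a b : k)
    (x : Fin 3 → A) : gradient (weier a b) x = ![2 * x 0 * x 2,
      -3 * x 1 ^ 2 - algebraMap k A a * x 2 ^ 2,
      x 0 ^ 2 - 2 * algebraMap k A a * x 1 * x 2 - 3 * algebraMap k A b * x 2 ^ 2] := by
  funext i
  fin_cases i <;> simp [gradient, weier, pderiv_X] <;> ring

/-- The general ternary cubic. -/
noncomputable def ternaryCubic [CommRing k] (c : ℕ → ℕ → k) : MvPolynomial (Fin 3) k :=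
  C (c 3 0) * X 0 ^ 3 + C (c 2 1) * X 0 ^ 2 * X 1 + C (c 2 0) * X 0 ^ 2 * X 2 +
  C (c 1 2) * X 0 * X 1 ^ 2 + C (c 1 1) * X 0 * X 1 * X 2 + C (c 1 0) * X 0 * X 2 ^ 2 +
  C (c 0 3) * X 1 ^ 3 + C (c 0 2) * X 1 ^ 2 * X 2 + C (c 0 1) * X 1 * X 2 ^ 2 + C (c 0 0) * X 2 ^ 3

theorem exists_eq_ternaryCubic [CommRing k] {F : MvPolynomial (Fin 3) k} (hF : F.IsHomogeneous 3) :
    ∃ c, F = ternaryCubic c := by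
  rw [F.as_sum]
  refine Finset.sum_induction _ (fun G => ∃ c, G = ternaryCubic c) ?_ ?_ ?_
  · rintro _ _ ⟨c, rfl⟩ ⟨d, rfl⟩
    refine ⟨c + d, ?_⟩
    simp only [ternaryCubic, Pi.add_apply, map_add]
    ring
  · exact ⟨0, by simp [ternaryCubic]⟩
  · intro d hd
    have h := hF (mem_support_iff.mp hd)
    rw [Finsupp.weight_apply, Finsupp.sum_fintype _ _ (by simp), Fin.sum_univ_three] at h
    simp only [Pi.one_apply, smul_eq_mul, mul_one] at h
    rw [monomial_eq, Finsupp.prod_fintype _ _ (by simp), Fin.prod_univ_three]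
    generalize coeff d F = v
    -- `c i j` is the coefficient of `X₀ⁱ X₁ʲ X₂^(3-i-j)`; the last exponent is implied by
    -- homogeneity.
    refine ⟨fun i j => if i = d 0 ∧ j = d 1 then v else 0, ?_⟩
    have h2 : d 2 = 3 - d 0 - d 1 := by omega
    have h01 : d 0 + d 1 ≤ 3 := by omega
    rw [h2]
    generalize d 0 = i at *
    generalize d 1 = j at *
    clear h h2 hd
    have hi : i ≤ 3 := by omega
    interval_cases i <;> (have hj : j ≤ 3 := by omega) <;> interval_cases j <;>
      first | omega | (simp [ternaryCubic]; try ring)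

end NormalForm

/-! ### Weierstrass form of a smooth cubic with a rational flex -/

section NormalForm

open MvPolynomial

variable {k : Type*} [Field k]

theorem aeval_ternaryCubic {A : Type*} [CommRing A] [Algebra k A] (c : ℕ → ℕ → k)
    (x : Fin 3 → A) : aeval x (ternaryCubic c) =
      algebraMap k A (c 3 0) * x 0 ^ 3 + algebraMap k A (c 2 1) * x 0 ^ 2 * x 1 +
      algebraMap k A (c 2 0) * x 0 ^ 2 * x 2 + algebraMap k A (c 1 2) * x 0 * x 1 ^ 2 +
      algebraMap k A (c 1 1) * x 0 * x 1 * x 2 + algebraMap k A (c 1 0) * x 0 * x 2 ^ 2 +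
      algebraMap k A (c 0 3) * x 1 ^ 3 + algebraMap k A (c 0 2) * x 1 ^ 2 * x 2 +
      algebraMap k A (c 0 1) * x 1 * x 2 ^ 2 + algebraMap k A (c 0 0) * x 2 ^ 3 := by
  simp [ternaryCubic]

theorem gradient_ternaryCubic {A : Type*} [CommRing A] [Algebra k A] (c : ℕ → ℕ → k)
    (x : Fin 3 → A) : gradient (ternaryCubic c) x =
      ![3 * algebraMap k A (c 3 0) * x 0 ^ 2 + 2 * algebraMap k A (c 2 1) * x 0 * x 1 +
          2 * algebraMap k A (c 2 0) * x 0 * x 2 + algebraMap k A (c 1 2) * x 1 ^ 2 +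
          algebraMap k A (c 1 1) * x 1 * x 2 + algebraMap k A (c 1 0) * x 2 ^ 2,
        algebraMap k A (c 2 1) * x 0 ^ 2 + 2 * algebraMap k A (c 1 2) * x 0 * x 1 +
          algebraMap k A (c 1 1) * x 0 * x 2 + 3 * algebraMap k A (c 0 3) * x 1 ^ 2 +
          2 * algebraMap k A (c 0 2) * x 1 * x 2 + algebraMap k A (c 0 1) * x 2 ^ 2,
        algebraMap k A (c 2 0) * x 0 ^ 2 + algebraMap k A (c 1 1) * x 0 * x 1 +
          2 * algebraMap k A (c 1 0) * x 0 * x 2 + algebraMap k A (c 0 2) * x 1 ^ 2 +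
          2 * algebraMap k A (c 0 1) * x 1 * x 2 + 3 * algebraMap k A (c 0 0) * x 2 ^ 2] := by
  funext i
  fin_cases i <;> simp [gradient, ternaryCubic, pderiv_X] <;> ring

theorem mulVec_ne_zero_of_mul_eq_one {A : Type*} [CommRing A] {M N : Matrix (Fin 3) (Fin 3) A}
    (h : M * N = 1) {x : Fin 3 → A} (hx : x ≠ 0) : N *ᵥ x ≠ 0 := by
  intro h0
  apply hx
  rw [← Matrix.one_mulVec x, ← h, ← Matrix.mulVec_mulVec, h0, Matrix.mulVec_zero]

theorem map_mul_eq_one {A : Type*} [CommRing A] [Algebra k A] {M N : Matrix (Fin 3) (Fin 3) k}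
    (h : M * N = 1) : M.map (algebraMap k A) * N.map (algebraMap k A) = 1 := by
  rw [← Matrix.map_mul, h, Matrix.map_one _ (map_zero _) (map_one _)]

theorem transpose_mul_eq_one {A : Type*} [CommRing A] {M N : Matrix (Fin 3) (Fin 3) A}
    (h : M * N = 1) : Nᵀ * Mᵀ = 1 := by
  rw [← Matrix.transpose_mul, h, Matrix.transpose_one]

theorem subst_homogeneous (N : Matrix (Fin 3) (Fin 3) k) {F : MvPolynomial (Fin 3) k} {n : ℕ}
    (hF : F.IsHomogeneous n) : (subst N F).IsHomogeneous n := by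
  have := hF.aeval (fun i => ∑ j, C (N i j) * X j : Fin 3 → MvPolynomial (Fin 3) k)
    (n := 1) (fun i => IsHomogeneous.sum _ _ _ fun j _ => by
      simpa using (isHomogeneous_C (Fin 3) (N i j)).mul (isHomogeneous_X k j))
  simpa [subst] using this

theorem IsSmoothCubic.subst {F : MvPolynomial (Fin 3) k} (hF : IsSmoothCubic F)
    {M N : Matrix (Fin 3) (Fin 3) k} (hMN : M * N = 1) : IsSmoothCubic (subst N F) := by
  refine ⟨subst_homogeneous N hF.homogeneous, fun x hx h => ?_⟩
  rw [aeval_subst] at h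
  rw [gradient_subst]
  refine mulVec_ne_zero_of_mul_eq_one (M := (M.map (algebraMap k (AlgebraicClosure k)))ᵀ) ?_
    (hF.smooth _ (mulVec_ne_zero_of_mul_eq_one (map_mul_eq_one hMN) hx) h)
  exact transpose_mul_eq_one (map_mul_eq_one (mul_eq_one_comm.mp hMN))

theorem IsSmoothCubic.C_mul {F : MvPolynomial (Fin 3) k} {c : k}
    (hF : IsSmoothCubic (C c * F)) (hF' : F.IsHomogeneous 3) : IsSmoothCubic F := by
  refine ⟨hF', fun x hx h h' => hF.smooth x hx ?_ ?_⟩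
  · rw [map_mul, h, mul_zero]
  · rw [gradient_C_mul, h', smul_zero]

/-- A point of the projective plane and a line through it are a coordinate point and a coordinate
line in suitable coordinates. -/
theorem exists_matrix_of_flag {p g : Fin 3 → k} (hp : p ≠ 0) (hg : g ≠ 0) (hgp : g ⬝ᵥ p = 0) :
    ∃ (M N : Matrix (Fin 3) (Fin 3) k), M * N = 1 ∧ M *ᵥ ![1, 0, 0] = p ∧
      g ⬝ᵥ (M *ᵥ ![0, 1, 0]) = 0 ∧ Mᵀ *ᵥ g = ![0, 0, 1] := by
  obtain ⟨j, hj⟩ := Function.ne_iff.mp hg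
  rw [Pi.zero_apply] at hj
  -- Otherwise the kernel of `g`, of dimension at least two, would be contained in the line spanned
  -- by `p`.
  obtain ⟨q, hq, hqp⟩ : ∃ q, g ⬝ᵥ q = 0 ∧ ∀ c : k, q ≠ c • p := by
    by_contra! H
    let f : (Fin 3 → k) →ₗ[k] k :=
      { toFun := fun q => g ⬝ᵥ q, map_add' := dotProduct_add g, map_smul' := by simp }
    have h1 := f.finrank_range_add_finrank_ker
    have h2 : LinearMap.ker f ≤ Submodule.span k {p} := by
      intro q hq
      obtain ⟨c, hc⟩ := H q hq
      exact Submodule.mem_span_singleton.mpr ⟨c, hc.symm⟩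
    have h3 := (Submodule.finrank_mono h2).trans (finrank_span_le_card {p})
    have h4 := LinearMap.range f |>.finrank_le
    simp at h1 h3 h4
    omega
  have hli : LinearIndependent k ![p, q, (g j)⁻¹ • Pi.single j 1] := by
    rw [Fintype.linearIndependent_iff]
    intro c hc
    rw [Fin.sum_univ_three] at hc
    have h2 : c 2 = 0 := by
      have := congrArg (fun v => g ⬝ᵥ v) hc
      simpa [dotProduct_add, hgp, hq, hj] using this
    have h1 : c 1 = 0 := by
      by_contra h1
      apply hqp (-(c 1)⁻¹ * c 0)
      have : c 1 • q = -(c 0 • p) := by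
        simp only [h2] at hc
        simp at hc
        exact eq_neg_of_add_eq_zero_right hc
      rw [← inv_smul_smul₀ h1 q, this, smul_neg, smul_smul, neg_mul, neg_smul]
    have h0 : c 0 = 0 := by
      simp [h1, h2] at hc
      exact hc.resolve_right hp
    intro i
    fin_cases i <;> assumption
  have hu := Matrix.linearIndependent_rows_iff_isUnit
    (A := Matrix.of ![p, q, (g j)⁻¹ • Pi.single j 1]) |>.mp hli
  set R := Matrix.of ![p, q, (g j)⁻¹ • Pi.single j 1] with hR
  obtain ⟨S, hS⟩ := hu.exists_left_inv
  refine ⟨Rᵀ, Sᵀ, transpose_mul_eq_one hS, ?_, ?_, ?_⟩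
  · funext i; simp [Matrix.mulVec, dotProduct, Fin.sum_univ_three, hR]
  · convert hq using 2
    funext i; simp [Matrix.mulVec, dotProduct, Fin.sum_univ_three, hR]
  · rw [Matrix.transpose_transpose]
    funext i
    have : ∀ i, (R *ᵥ g) i = g ⬝ᵥ R i := fun i => dotProduct_comm _ _
    rw [this]
    fin_cases i
    · exact hgp
    · exact hq
    · change g ⬝ᵥ ((g j)⁻¹ • Pi.single j 1) = 1
      simp [hj]

theorem aeval_map_algebraMap_ne_zero {n : Type*} {A : Type*} [CommRing A] [Nontrivial A]
    [Algebra k A] {p : n → k} (hp : p ≠ 0) : (fun i => algebraMap k A (p i)) ≠ 0 := by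
  obtain ⟨i, hi⟩ := Function.ne_iff.mp hp
  intro h
  apply hi
  apply (algebraMap k A).injective
  rw [Pi.zero_apply, map_zero]
  exact congrFun h i

theorem gradient_ne_zero {F : MvPolynomial (Fin 3) k} (hF : IsSmoothCubic F) {p : Fin 3 → k}
    (hp : p ≠ 0) (h : aeval p F = 0) : gradient F p ≠ 0 := by
  have hc : ∀ G : MvPolynomial (Fin 3) k,
      aeval (fun i => algebraMap k (AlgebraicClosure k) (p i)) G = algebraMap _ _ (aeval p G) :=
    fun G => aeval_algebraMap_apply _ _ _
  intro h0
  refine hF.smooth _ (aeval_map_algebraMap_ne_zero hp) (by rw [hc, h, map_zero]) ?_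
  funext i
  rw [gradient, hc]
  have := congrFun h0 i
  rw [gradient] at this
  rw [this, Pi.zero_apply, map_zero]; rfl

/-- Smoothness of a Weierstrass cubic. -/
theorem disc_ne_zero_of_isSmoothCubic (h2 : (2 : k) ≠ 0) (h3 : (3 : k) ≠ 0) {a b : k}
    (h : IsSmoothCubic (weier a b)) : 4 * a ^ 3 + 27 * b ^ 2 ≠ 0 := by
  intro hd
  -- `e` is a multiple root of `x³ + ax + b`, so `(e, 0)` is singular: it is `0` if `a = 0` and `-3b
  -- / (2a)` otherwise.
  obtain ⟨e, he1, he2⟩ : ∃ e, e ^ 3 + a * e + b = 0 ∧ 3 * e ^ 2 + a = 0 := by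
    by_cases ha : a = 0
    · refine ⟨0, ?_, ?_⟩
      · have : b ^ 2 = 0 := by
          apply (mul_eq_zero.mp (?_ : (2 ^ 0 * 3 ^ 3 : k) * b ^ 2 = 0)).resolve_left
            (natCast_ne_zero_of_two_three h2 h3 0 3)
          rw [ha] at hd; linear_combination hd
        rw [pow_eq_zero_iff two_ne_zero] at this
        simp [this]
      · simp [ha]
    · refine ⟨-3 * b / (2 * a), ?_, ?_⟩
      · field_simp; linear_combination -b * hd
      · field_simp; linear_combination hd
  refine gradient_ne_zero h (p := ![0, e, 1]) (fun h => by simpa using congrFun h 2) ?_ ?_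
  · rw [aeval_weier]; simp; linear_combination -he1
  · rw [gradient_weier]
    funext i
    fin_cases i
    · simp
    · simp; linear_combination -he2
    · simp; linear_combination -3 * he1 + e * he2

/-- A smooth plane cubic with a rational flex has a Weierstrass form. -/
theorem exists_weierstrass_form (h2 : (2 : k) ≠ 0) (h3 : (3 : k) ≠ 0)
    {F : MvPolynomial (Fin 3) k} (hF : IsSmoothCubic F) {p : Fin 3 → k} (hp : IsFlex F p) :
    ∃ (a b κ : k) (M N : Matrix (Fin 3) (Fin 3) k), M * N = 1 ∧ κ ≠ 0 ∧
      4 * a ^ 3 + 27 * b ^ 2 ≠ 0 ∧ F = C κ * subst N (weier a b) ∧ N *ᵥ p = ![1, 0, 0] := by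
  have hg := gradient_ne_zero hF hp.ne_zero hp.mem
  -- Euler's identity.
  have hgp : gradient F p ⬝ᵥ p = 0 := by
    have := congrArg (aeval p) hF.homogeneous.sum_X_mul_pderiv
    rw [map_sum, map_nsmul, hp.mem, smul_zero] at this
    rw [← this, dotProduct]
    exact Finset.sum_congr rfl fun i _ => by rw [map_mul, aeval_X, gradient, mul_comm]
  obtain ⟨M, N, hMN, hMp, hMq, hMg⟩ := exists_matrix_of_flag hp.ne_zero hg hgp
  have hNM := mul_eq_one_comm.mp hMN
  have hsm := hF.subst (M := N) (N := M) hNM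
  obtain ⟨c, hc⟩ := exists_eq_ternaryCubic hsm.homogeneous
  rw [hc] at hsm
  have hid : M.map (algebraMap k k) = M := by ext; simp
  have c30 : c 3 0 = 0 := by
    have := aeval_subst M F (![1, 0, 0] : Fin 3 → k)
    rw [hid, hMp, hp.mem, hc, aeval_ternaryCubic] at this
    simpa using this
  have hgr : gradient (ternaryCubic c) (![1, 0, 0] : Fin 3 → k) = ![0, 0, 1] := by
    rw [← hc, gradient_subst, hid, hMp, hMg]
  rw [gradient_ternaryCubic] at hgr
  have c21 : c 2 1 = 0 := by simpa using congrFun hgr 1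
  have c20 : c 2 0 = 1 := by simpa using congrFun hgr 2
  -- On the tangent line, parametrized by `(1, X, 0)`, this is the coefficient of `X²`; it vanishes
  -- because the contact has order three.
  have c12 : c 1 2 = 0 := by
    have := hp.flex _ hMq
    have e : (fun i => Polynomial.C (p i) + Polynomial.X * Polynomial.C ((M *ᵥ ![0, 1, 0]) i)) =
        M.map (algebraMap k k[X]) *ᵥ ![1, Polynomial.X, 0] := by
      rw [← hMp]
      funext i
      simp [Matrix.mulVec, dotProduct, Fin.sum_univ_three]
    rw [e, ← aeval_subst, hc, aeval_ternaryCubic] at this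
    have := (Polynomial.X_pow_dvd_iff.mp this) 2 (by norm_num)
    simpa [c30, c21, c20, Polynomial.coeff_X, mul_assoc, Polynomial.coeff_C_mul,
      Polynomial.coeff_X_pow] using this
  set α := c 0 3 with hα
  -- If `α = 0`, the cubic contains the line `X₂ = 0`, and a root of the quadratic below is a
  -- singular point on it.
  have hα0 : α ≠ 0 := by
    intro h0
    let κ := AlgebraicClosure k
    obtain ⟨r, hr⟩ := IsAlgClosed.exists_root (Polynomial.X ^ 2 +
      Polynomial.C (algebraMap k κ (c 1 1)) * Polynomial.X +
      Polynomial.C (algebraMap k κ (c 0 2)) : κ[X]) (by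
        rw [show (Polynomial.X ^ 2 + Polynomial.C (algebraMap k κ (c 1 1)) * Polynomial.X +
          Polynomial.C (algebraMap k κ (c 0 2)) : κ[X]).degree = 2 by compute_degree!]
        norm_num)
    simp only [Polynomial.IsRoot.def, Polynomial.eval_add, Polynomial.eval_pow, Polynomial.eval_X,
      Polynomial.eval_mul, Polynomial.eval_C] at hr
    refine hsm.smooth ![r, 1, 0] (fun h => by simpa using congrFun h 1) ?_ ?_
    · rw [aeval_ternaryCubic]; simp [c30, c21, c20, c12, ← hα, h0]
    · rw [gradient_ternaryCubic]
      funext i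
      fin_cases i <;> simp [c30, c21, c20, c12, ← hα, h0]
      exact hr
  -- `u` and `v` complete the square in the first variable, `e` completes the cube in the second,
  -- and `l = -1/α` rescales the third.
  obtain ⟨u, hu⟩ : ∃ u, c 1 1 = 2 * u := ⟨c 1 1 / 2, by field_simp⟩
  obtain ⟨v, hv⟩ : ∃ v, c 1 0 = 2 * v := ⟨c 1 0 / 2, by field_simp⟩
  obtain ⟨e, he⟩ : ∃ e, c 0 2 = u ^ 2 + 3 * α * e := ⟨(c 0 2 - u ^ 2) / (3 * α), by field_simp; ring⟩
  obtain ⟨l, hl⟩ : ∃ l, α * l = -1 := ⟨-α⁻¹, by field_simp⟩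
  obtain ⟨q, hq⟩ : ∃ q, c 0 1 = q + 2 * u * v + 3 * α * e ^ 2 :=
    ⟨c 0 1 - 2 * u * v - 3 * α * e ^ 2, by ring⟩
  obtain ⟨r, hr⟩ : ∃ r, c 0 0 = r + v ^ 2 + α * e ^ 3 + e * q :=
    ⟨c 0 0 - v ^ 2 - α * e ^ 3 - e * q, by ring⟩
  let P : Matrix (Fin 3) (Fin 3) k := !![1, u, v; 0, 1, e; 0, 0, l]
  let P' : Matrix (Fin 3) (Fin 3) k := !![1, -u, (v - u * e) * α; 0, 1, e * α; 0, 0, -α]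
  have hPP : P * P' = 1 := by
    ext i j
    fin_cases i <;> fin_cases j <;> simp [P, P', Matrix.mul_apply, Fin.sum_univ_three]
    · ring
    · linear_combination -hl
  have key : ternaryCubic c = C (-α) * subst P (weier (α * q) (-α ^ 2 * r)) := by
    have hl' : (C α * C l : MvPolynomial (Fin 3) k) = -1 := by rw [← C_mul, hl]; simp
    have h3 : (C 3 : MvPolynomial (Fin 3) k) = 3 := map_ofNat _ _
    have h2 : (C 2 : MvPolynomial (Fin 3) k) = 2 := map_ofNat _ _
    have hs : subst P (weier (α * q) (-α ^ 2 * r)) =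
        (X 0 + C u * X 1 + C v * X 2) ^ 2 * (C l * X 2) - (X 1 + C e * X 2) ^ 3 -
          C α * C q * (X 1 + C e * X 2) * (C l * X 2) ^ 2 + C α ^ 2 * C r * (C l * X 2) ^ 3 := by
      rw [subst, aeval_weier]
      simp [P, Fin.sum_univ_three]
    rw [hs, ternaryCubic, c30, c21, c20, c12, hu, hv, he, hq, hr, ← hα]
    simp only [C_mul, C_add, C_pow, C_0, C_1, C_neg, h2, h3]
    linear_combination (X 0 + C u * X 1 + C v * X 2) ^ 2 * X 2 * hl' -
      (C α * C l - 1) * C q * (X 1 + C e * X 2) * X 2 ^ 2 * hl' +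
      ((C α * C l) ^ 2 - C α * C l + 1) * C r * X 2 ^ 3 * hl'
  refine ⟨α * q, -α ^ 2 * r, -α, M * P', P * N, ?_, neg_ne_zero.mpr hα0, ?_, ?_, ?_⟩
  · rw [Matrix.mul_assoc, ← Matrix.mul_assoc P', mul_eq_one_comm.mp hPP, Matrix.one_mul, hMN]
  · rw [key] at hsm
    have h1 := hsm.C_mul (subst_homogeneous P ?_)
    · have := h1.subst (M := P) (N := P') hPP
      rw [subst_subst, hPP, subst_one] at this
      exact disc_ne_zero_of_isSmoothCubic h2 h3 this
    · have hX : ∀ i, (X i : MvPolynomial (Fin 3) k).IsHomogeneous 1 := isHomogeneous_X k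
      have hC : ∀ r : k, (C r : MvPolynomial (Fin 3) k).IsHomogeneous 0 := isHomogeneous_C _
      rw [weier]
      exact ((((hX 0).pow 2).mul (hX 2)).sub ((hX 1).pow 3)).sub
        (((hC _).mul (hX 1)).mul ((hX 2).pow 2)) |>.sub ((hC _).mul ((hX 2).pow 3))
  · rw [← subst_subst, ← subst_one F, ← hMN, ← subst_subst, hc, key, map_mul]
    simp [subst]
  · rw [← Matrix.mulVec_mulVec, ← hMp, Matrix.mulVec_mulVec _ N, hNM, Matrix.one_mulVec]
    funext i
    fin_cases i <;> simp [P, Matrix.mulVec, dotProduct, Fin.sum_univ_three]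

end NormalForm

/-! ### The equation of the dual curve -/

section Dual

open MvPolynomial

/-- The equation of the dual of the Weierstrass cubic `weier a b`; the variables `(X 0, X 1, X 2)`
stand for the line `X 0 * Y + X 1 * X + X 2 * Z = 0`. -/
noncomputable def dualForm {R : Type*} [CommRing R] (a b : R) : MvPolynomial (Fin 3) R :=
  C (-(4 * a ^ 3 + 27 * b ^ 2)) * X 0 ^ 6 +
    (C (54 * b) * X 2 ^ 2 + C (24 * a ^ 2) * X 1 * X 2 - C (18 * a * b) * X 1 ^ 2) * X 0 ^ 4 +
    (C (-27) * X 2 ^ 4 - C (30 * a) * X 1 ^ 2 * X 2 ^ 2 + C (36 * b) * X 1 ^ 3 * X 2 +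
      C (a ^ 2) * X 1 ^ 4) * X 0 ^ 2 +
    (C (-4) * X 1 ^ 3 * X 2 ^ 3 - C (4 * a) * X 1 ^ 5 * X 2 + C (4 * b) * X 1 ^ 6)

theorem aeval_dualForm {R A : Type*} [CommRing R] [CommRing A] [Algebra R A] (a b : R)
    (v : Fin 3 → A) : aeval v (dualForm a b) =
      -(4 * algebraMap R A a ^ 3 + 27 * algebraMap R A b ^ 2) * v 0 ^ 6 +
      (54 * algebraMap R A b * v 2 ^ 2 + 24 * algebraMap R A a ^ 2 * v 1 * v 2 -
        18 * algebraMap R A a * algebraMap R A b * v 1 ^ 2) * v 0 ^ 4 +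
      (-27 * v 2 ^ 4 - 30 * algebraMap R A a * v 1 ^ 2 * v 2 ^ 2 +
        36 * algebraMap R A b * v 1 ^ 3 * v 2 + algebraMap R A a ^ 2 * v 1 ^ 4) * v 0 ^ 2 +
      (-4 * v 1 ^ 3 * v 2 ^ 3 - 4 * algebraMap R A a * v 1 ^ 5 * v 2 +
        4 * algebraMap R A b * v 1 ^ 6) := by
  simp only [dualForm, map_add, map_sub, map_mul, map_pow, map_neg, map_ofNat, aeval_X,
    algHom_C]

variable {κ : Type*} [Field κ]

/-- A line is tangent to a Weierstrass cubic at one point at most. -/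
theorem eq_of_bitangent {a b x x' s x₀ : κ} (hs : s ≠ 0)
    (h₁ : s * (x ^ 3 + a * x + b) = (x₀ - x) ^ 2) (h₂ : s * (3 * x ^ 2 + a) = -2 * (x₀ - x))
    (h₃ : s * (x' ^ 3 + a * x' + b) = (x₀ - x') ^ 2)
    (h₄ : s * (3 * x' ^ 2 + a) = -2 * (x₀ - x')) : x = x' := by
  have : s * (x - x') ^ 3 = 0 := by
    linear_combination -2 * h₁ + 2 * h₃ + (x - x') * (h₂ + h₄)
  exact sub_eq_zero.mp ((pow_eq_zero_iff three_ne_zero).mp ((mul_eq_zero.mp this).resolve_left hs))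

/-- Fixing `u` and `w` means fixing the point `(x₀, 0)`, `x₀ = -w/u`, on the line. The tangents from
it touch the cubic at abscissas that are roots of a cubic `T`, and each root carries two points
`±y`. Generically this gives six tangents, since no line is tangent twice. -/
theorem exists_six_tangents [IsAlgClosed κ] (h2 : (2 : κ) ≠ 0) (h3 : (3 : κ) ≠ 0) {a b : κ}
    (hd : 4 * a ^ 3 + 27 * b ^ 2 ≠ 0) : ∃ B : Finset κ, ∀ u w : κ, u ≠ 0 →
      (∀ β ∈ B, w + β * u ≠ 0) → ∃ S : Finset κ, S.card = 6 ∧ ∀ v ∈ S, ∃ x y c : κ,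
        y ^ 2 = x ^ 3 + a * x + b ∧ v = c * (2 * y) ∧ u = c * (-3 * x ^ 2 - a) ∧
          w = c * (y ^ 2 - 2 * a * x - 3 * b) := by
  classical
  let f : κ[X] := Polynomial.X ^ 3 + Polynomial.C a * Polynomial.X + Polynomial.C b
  let ψ : κ[X] := Polynomial.C 3 * Polynomial.X ^ 4 + Polynomial.C (6 * a) * Polynomial.X ^ 2 +
    Polynomial.C (12 * b) * Polynomial.X - Polynomial.C (a ^ 2)
  have hf : f.natDegree = 3 := by simp only [f]; compute_degree!
  have hψ : ψ.natDegree = 4 := by simp only [ψ]; compute_degree!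
  have hf0 : f ≠ 0 := fun h => by rw [h] at hf; simp at hf
  have hψ0 : ψ ≠ 0 := fun h => by rw [h] at hψ; simp at hψ
  -- The excluded `x₀`: the 2-torsion abscissas, and the points where flex tangents meet the
  -- `x`-axis (`ψ` is the 3-division polynomial).
  refine ⟨f.roots.toFinset ∪ ψ.roots.toFinset.image
    (fun x => (x ^ 3 - a * x - 2 * b) / (3 * x ^ 2 + a)), fun u w hu hB => ?_⟩
  obtain ⟨x₀, rfl⟩ : ∃ x₀, w = -x₀ * u := ⟨-w / u, by field_simp⟩
  -- `T = (x - x₀) f' - 2f` up to sign: the tangent at `(x, y)` passes through `(x₀, 0)` if and only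
  -- if `2f = (x - x₀) f'`.
  let T : κ[X] := Polynomial.X ^ 3 - Polynomial.C (3 * x₀) * Polynomial.X ^ 2 -
    Polynomial.C a * Polynomial.X - Polynomial.C (2 * b + a * x₀)
  have hT : T.natDegree = 3 := by simp only [T]; compute_degree!
  have hT0 : T ≠ 0 := fun h => by rw [h] at hT; simp at hT
  have hTe : ∀ x, T.eval x = x ^ 3 - a * x - 2 * b - x₀ * (3 * x ^ 2 + a) := by
    intro x; simp [T]; ring
  have hTd : ∀ x, T.derivative.eval x = 3 * x ^ 2 - 6 * x₀ * x - a := by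
    intro x; simp [T]; ring
  have hd1 : ∀ x, T.eval x = 0 → 3 * x ^ 2 + a ≠ 0 := by
    intro x hx h
    rw [hTe, h] at hx
    obtain rfl : a = -3 * x ^ 2 := by linear_combination h
    have : 2 * b = 2 * (2 * x ^ 3) := by linear_combination -hx
    obtain rfl := mul_left_cancel₀ h2 this
    apply hd; ring
  have hfx : ∀ x, T.eval x = 0 → x ^ 3 + a * x + b ≠ 0 := by
    intro x hx h
    have h0 : x = x₀ := by
      have := hd1 x hx
      rw [hTe] at hx
      apply mul_left_cancel₀ this
      linear_combination 2 * h + hx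
    refine hB x₀ (Finset.mem_union_left _ ?_) (by ring)
    rw [Multiset.mem_toFinset, Polynomial.mem_roots hf0, Polynomial.IsRoot.def, ← h0]
    simpa [f] using h
  -- Eliminating `x₀` from `T = T' = 0` gives `ψ(x) = 0`, an excluded case.
  have hsep : T.Separable := by
    rw [Polynomial.separable_def, Polynomial.isCoprime_iff_aeval_ne_zero_of_isAlgClosed κ κ]
    intro x
    by_contra! H
    simp only [Polynomial.coe_aeval_eq_eval] at H
    obtain ⟨H1, H2⟩ := H
    have h1 := hd1 x H1
    rw [hTe] at H1
    rw [hTd] at H2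
    refine hB x₀ (Finset.mem_union_right _ (Finset.mem_image.mpr ⟨x, ?_, ?_⟩)) (by ring)
    · rw [Multiset.mem_toFinset, Polynomial.mem_roots hψ0, Polynomial.IsRoot.def]
      simp only [ψ, Polynomial.eval_add, Polynomial.eval_sub, Polynomial.eval_mul,
        Polynomial.eval_C, Polynomial.eval_pow, Polynomial.eval_X]
      linear_combination (3 * x ^ 2 + a) * H2 - 6 * x * H1
    · rw [div_eq_iff h1]
      linear_combination H1
  have hcard : T.roots.toFinset.card = 3 := by
    rw [Multiset.toFinset_card_of_nodup (Polynomial.nodup_roots hsep), ← hT]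
    exact (IsAlgClosed.splits T).natDegree_eq_card_roots.symm
  choose y hy using fun x : κ => IsAlgClosed.exists_pow_nat_eq (x ^ 3 + a * x + b) two_pos
  have h1 : (1 : κ) ≠ -1 := by
    intro h; apply h2; linear_combination h
  have hroot : ∀ x, x ∈ T.roots.toFinset → T.eval x = 0 := by
    intro x hx
    rwa [Multiset.mem_toFinset, Polynomial.mem_roots hT0] at hx
  have hS : ∀ x ε : κ, ε ∈ ({1, -1} : Finset κ) → ε ^ 2 = 1 := by
    intro x ε hε
    simp only [Finset.mem_insert, Finset.mem_singleton] at hε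
    rcases hε with rfl | rfl <;> ring
  refine ⟨(T.roots.toFinset ×ˢ ({1, -1} : Finset κ)).image
    (fun q => -u / (3 * q.1 ^ 2 + a) * (2 * (q.2 * y q.1))), ?_, ?_⟩
  · rw [Finset.card_image_of_injOn, Finset.card_product, hcard, Finset.card_pair h1]
    rintro ⟨x, ε⟩ hx ⟨x', ε'⟩ hx' h
    rw [Finset.mem_coe, Finset.mem_product] at hx hx'
    have e1 := hroot _ hx.1
    have e2 := hroot _ hx'.1
    have s1 := hS x _ hx.2
    have s2 := hS x' _ hx'.2
    simp only at h e1 e2 s1 s2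
    have n1 := hd1 _ e1
    have n2 := hd1 _ e2
    have m1 := hfx _ e1
    rw [hTe] at e1 e2
    have hε : ε ≠ 0 := by rintro rfl; simp at s1
    have hy0 : y x ≠ 0 := by intro h0; apply m1; rw [← hy, h0]; ring
    -- `l` is the inverse slope of the tangent. Equal values of `v` give equal `l`, so both contact
    -- points lie on one line and `eq_of_bitangent` applies.
    obtain ⟨l, hl⟩ : ∃ l, l = 2 * (ε * y x) / (3 * x ^ 2 + a) := ⟨_, rfl⟩
    have hl0 : l ≠ 0 := by
      rw [hl]; exact div_ne_zero (mul_ne_zero h2 (mul_ne_zero hε hy0)) n1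
    have hl1 : l * (3 * x ^ 2 + a) = 2 * (ε * y x) := by rw [hl]; field_simp
    have hl2 : l * (3 * x' ^ 2 + a) = 2 * (ε' * y x') := by
      have : l = 2 * (ε' * y x') / (3 * x' ^ 2 + a) := by
        rw [hl]
        apply mul_left_cancel₀ (neg_ne_zero.mpr hu)
        rw [mul_div_assoc', mul_div_assoc']
        rw [div_mul_eq_mul_div, div_mul_eq_mul_div] at h
        exact h
      rw [this]; field_simp
    have key : ∀ x ε : κ, ε ^ 2 = 1 → x ^ 3 - a * x - 2 * b - x₀ * (3 * x ^ 2 + a) = 0 →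
        3 * x ^ 2 + a ≠ 0 → l * (3 * x ^ 2 + a) = 2 * (ε * y x) →
        l ^ 2 * (x ^ 3 + a * x + b) = (x₀ - x) ^ 2 ∧
          l ^ 2 * (3 * x ^ 2 + a) = -2 * (x₀ - x) := by
      intro x ε hε hx hn hl
      have hq : l ^ 2 * (3 * x ^ 2 + a) = -2 * (x₀ - x) := by
        apply mul_right_cancel₀ hn
        linear_combination (l * (3 * x ^ 2 + a) + 2 * (ε * y x)) * hl + 4 * ε ^ 2 * hy x +
          4 * (x ^ 3 + a * x + b) * hε - 2 * hx
      refine ⟨?_, hq⟩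
      apply mul_left_cancel₀ h2
      linear_combination (x - x₀) * hq - l ^ 2 * hx
    obtain ⟨k1, k2⟩ := key x ε s1 e1 n1 hl1
    obtain ⟨k3, k4⟩ := key x' ε' s2 e2 n2 hl2
    obtain rfl := eq_of_bitangent (pow_ne_zero 2 hl0) k1 k2 k3 k4
    have : ε = ε' := by
      apply mul_right_cancel₀ hy0
      apply mul_left_cancel₀ h2
      rw [← hl1, hl2]
    rw [this]
  · intro v hv
    obtain ⟨⟨x, ε⟩, hx, rfl⟩ := Finset.mem_image.mp hv
    rw [Finset.mem_product] at hx
    have e1 := hroot _ hx.1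
    have s1 := hS x _ hx.2
    simp only at e1 s1
    have n1 := hd1 _ e1
    rw [hTe] at e1
    have hq : (ε * y x) ^ 2 = x ^ 3 + a * x + b := by rw [mul_pow, hy, s1, one_mul]
    refine ⟨x, ε * y x, -u / (3 * x ^ 2 + a), hq, rfl, ?_, ?_⟩
    · field_simp; ring
    · rw [hq]; field_simp; linear_combination e1

/-- As a polynomial in `X 0`, the dual form has degree six with constant leading coefficient, so `H`
can be divided by it. For generic values of the other two variables the remainder vanishes at the
six tangents found above, and its degree is less than six; hence it is zero. This also shows that
the dual form is reduced. -/
theorem dualForm_dvd [IsAlgClosed κ] (h2 : (2 : κ) ≠ 0) (h3 : (3 : κ) ≠ 0) {a b : κ}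
    (hd : 4 * a ^ 3 + 27 * b ^ 2 ≠ 0) {H : MvPolynomial (Fin 3) κ}
    (hH : ∀ x y c : κ, y ^ 2 = x ^ 3 + a * x + b →
      aeval ![c * (2 * y), c * (-3 * x ^ 2 - a), c * (y ^ 2 - 2 * a * x - 3 * b)] H = 0) :
    dualForm a b ∣ H := by
  obtain ⟨B, hB⟩ := exists_six_tangents h2 h3 hd
  let e := finSuccEquiv κ 2
  let δ : κ := (-(4 * a ^ 3 + 27 * b ^ 2))⁻¹
  have hδ : δ * (-(4 * a ^ 3 + 27 * b ^ 2)) = 1 := inv_mul_cancel₀ (neg_ne_zero.mpr hd)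
  obtain ⟨r₂, r₁, r₀, hr⟩ : ∃ r₂ r₁ r₀ : MvPolynomial (Fin 2) κ, e (C δ * dualForm a b) =
      Polynomial.X ^ 6 + Polynomial.C r₂ * Polynomial.X ^ 4 + Polynomial.C r₁ * Polynomial.X ^ 2 +
        Polynomial.C r₀ := by
    have e0 : e (X 0) = Polynomial.X := finSuccEquiv_X_zero
    have e1 : e (X 1) = Polynomial.C (X 0) := finSuccEquiv_X_succ (j := 0)
    have e2 : e (X 2) = Polynomial.C (X 1) := finSuccEquiv_X_succ (j := 1)
    have eC : ∀ c, e (C c) = Polynomial.C (C c) := fun c => by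
      simp [e, finSuccEquiv_apply]
    refine ⟨C δ * (C (54 * b) * X 1 ^ 2 + C (24 * a ^ 2) * X 0 * X 1 - C (18 * a * b) * X 0 ^ 2),
      C δ * (C (-27) * X 1 ^ 4 - C (30 * a) * X 0 ^ 2 * X 1 ^ 2 + C (36 * b) * X 0 ^ 3 * X 1 +
        C (a ^ 2) * X 0 ^ 4),
      C δ * (C (-4) * X 0 ^ 3 * X 1 ^ 3 - C (4 * a) * X 0 ^ 5 * X 1 + C (4 * b) * X 0 ^ 6), ?_⟩
    rw [dualForm, mul_add, mul_add, mul_add, ← mul_assoc, ← C_mul, hδ, C_1, one_mul,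
      ← mul_assoc (C δ), ← mul_assoc (C δ)]
    simp only [map_add e, map_mul e, map_pow e, map_sub e, e0, e1, e2, eC, Polynomial.C_mul,
      Polynomial.C_add, Polynomial.C_pow, Polynomial.C_sub]
  set D := e (C δ * dualForm a b)
  have hDd : D.natDegree = 6 := by rw [hr]; compute_degree!
  have hDm : D.Monic := by rw [hr]; monicity!
  have hR : e H %ₘ D = 0 := by
    ext1 i
    -- This factor vanishes at all non-generic values, so each coefficient of the remainder times it
    -- vanishes identically, the field being infinite.
    have hg : (X 0 * ∏ β ∈ B, (X 1 + C β * X 0) : MvPolynomial (Fin 2) κ) ≠ 0 := by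
      refine mul_ne_zero (X_ne_zero 0) (Finset.prod_ne_zero_iff.mpr fun β _ h => ?_)
      have := congrArg (eval ![0, 1]) h
      simp at this
    rw [Polynomial.coeff_zero]
    refine (mul_eq_zero.mp ?_).resolve_right hg
    refine MvPolynomial.funext fun s => ?_
    rw [map_mul, map_zero]
    by_cases hs : eval s (X 0 * ∏ β ∈ B, (X 1 + C β * X 0) : MvPolynomial (Fin 2) κ) = 0
    · rw [hs, mul_zero]
    rw [map_mul, map_prod] at hs
    have hs0 := left_ne_zero_of_mul hs
    have hs1 := Finset.prod_ne_zero_iff.mp (right_ne_zero_of_mul hs)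
    simp only [map_add, map_mul, eval_X, eval_C] at hs0 hs1
    obtain ⟨S, hS6, hS⟩ := hB (s 0) (s 1) hs0 hs1
    have hzero : Polynomial.map (eval s) (e H %ₘ D) = 0 := by
      refine Polynomial.eq_zero_of_natDegree_lt_card_of_eval_eq_zero' _ S (fun v hv => ?_) ?_
      · obtain ⟨x, y, c, hy, h0, h1, h2⟩ := hS v hv
        have hv : (Fin.cons v s : Fin 3 → κ) =
            ![c * (2 * y), c * (-3 * x ^ 2 - a), c * (y ^ 2 - 2 * a * x - 3 * b)] := by
          funext i
          fin_cases i
          · exact h0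
          · exact h1
          · exact h2
        have k1 : Polynomial.eval v (Polynomial.map (eval s) (e H)) = 0 := by
          rw [← eval_eq_eval_mv_eval', hv, ← coe_aeval_eq_eval]; exact hH x y c hy
        have k2 : Polynomial.eval v (Polynomial.map (eval s) D) = 0 := by
          rw [← eval_eq_eval_mv_eval', hv, map_mul, ← coe_aeval_eq_eval]
          change _ * aeval _ _ = _
          rw [aeval_dualForm]
          obtain rfl : b = y ^ 2 - x ^ 3 - a * x := by rw [hy]; ring
          simp
          right
          ring
        have := congrArg (fun q => Polynomial.eval v (Polynomial.map (eval s) q))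
          (Polynomial.modByMonic_add_div (e H) D)
        simpa [k1, k2] using this
      · rw [hS6]
        refine lt_of_le_of_lt Polynomial.natDegree_map_le ?_
        rw [← hDd]
        exact Polynomial.natDegree_modByMonic_lt _ hDm fun h => by rw [h] at hDd; simp at hDd
    have := congrArg (fun q => q.coeff i) hzero
    simp only [Polynomial.coeff_map, Polynomial.coeff_zero] at this
    rw [this, zero_mul]
  have hdvd : D ∣ e H := (Polynomial.modByMonic_eq_zero_iff_dvd hDm).mp hR
  have : C δ * dualForm a b ∣ H := by
    have := map_dvd e.symm hdvd
    simpa [D] using this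
  exact (Dvd.intro_left _ rfl).trans this

variable {k : Type*} [Field k]

/-- The dual equation of a cubic with a Weierstrass form. -/
theorem isDualEquation_subst (h2 : (2 : k) ≠ 0) (h3 : (3 : k) ≠ 0) {a b c : k}
    (hd : 4 * a ^ 3 + 27 * b ^ 2 ≠ 0) (hc : c ≠ 0) {M N : Matrix (Fin 3) (Fin 3) k}
    (hMN : M * N = 1) :
    IsDualEquation (C c * subst N (weier a b))
      (subst (Mᵀ.map (algebraMap k (AlgebraicClosure k)))
        (dualForm (algebraMap k _ a) (algebraMap k _ b))) := by
  set ι := algebraMap k (AlgebraicClosure k) with hι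
  have hid : ∀ P : Matrix (Fin 3) (Fin 3) (AlgebraicClosure k),
      P.map (algebraMap (AlgebraicClosure k) (AlgebraicClosure k)) = P := by
    intro P; ext; simp
  have hMN' : M.map ι * N.map ι = 1 := map_mul_eq_one hMN
  have hNM' : N.map ι * M.map ι = 1 := mul_eq_one_comm.mp hMN'
  have hT : Mᵀ.map ι * (N.map ι)ᵀ = 1 := transpose_mul_eq_one hNM'
  have hT' : (N.map ι)ᵀ * Mᵀ.map ι = 1 := mul_eq_one_comm.mp hT
  have hc' : ι c ≠ 0 := (_root_.map_ne_zero _).mpr hc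
  rw [IsDualEquation]
  ext H
  rw [mem_vanishingIdeal_iff, Ideal.mem_span_singleton]
  constructor
  · intro h
    have := dualForm_dvd (κ := AlgebraicClosure k) (a := ι a) (b := ι b)
      (H := subst (N.map ι)ᵀ H)
      (by rw [← map_ofNat ι 2]; exact (_root_.map_ne_zero _).mpr h2)
      (by rw [← map_ofNat ι 3]; exact (_root_.map_ne_zero _).mpr h3)
      (by
        have := (_root_.map_ne_zero ι).mpr hd
        simpa only [map_add, map_mul, map_pow, map_ofNat] using this) ?_
    · have := map_dvd (subst (Mᵀ.map ι)) this
      rwa [subst_subst _ _ H, hT', subst_one] at this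
    · intro x y d hxy
      rw [aeval_subst, hid]
      apply h
      refine ⟨M.map ι *ᵥ ![y, x, 1], mulVec_ne_zero_of_mul_eq_one hNM'
        (fun h => by simpa using congrFun h 2), ?_, d / ι c, ?_⟩
      · rw [map_mul, aeval_subst, Matrix.mulVec_mulVec, hNM', Matrix.one_mulVec, aeval_weier]
        simp [hxy]; right; ring
      · rw [gradient_C_mul, gradient_subst, Matrix.mulVec_mulVec _ (N.map ι), hNM',
          Matrix.one_mulVec, gradient_weier, smul_smul, div_mul_cancel₀ _ hc',
          ← Matrix.mulVec_smul]
        congr 1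
        funext i
        fin_cases i <;> simp [hι]
  · rintro ⟨Q, rfl⟩ _ ⟨x, hx, hFx, d, rfl⟩
    rw [map_mul, aeval_subst] at hFx
    have hW := (mul_eq_zero.mp hFx).resolve_left (by simpa using hc')
    rw [map_mul, aeval_subst, hid, gradient_C_mul, gradient_subst, Matrix.mulVec_smul,
      Matrix.mulVec_smul, Matrix.mulVec_mulVec, hT, Matrix.one_mulVec, gradient_weier,
      aeval_dualForm]
    rw [aeval_weier] at hW
    generalize N.map (algebraMap k (AlgebraicClosure k)) *ᵥ x = z at hW
    rw [← hι] at hW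
    refine mul_eq_zero_of_left ?_ _
    simp only [Pi.smul_apply, smul_eq_mul, Matrix.cons_val, ← hι, Algebra.algebraMap_self_apply]
    generalize ι a = a at *
    generalize ι b = b at *
    -- The only point at infinity is the flex; elsewhere `b` is eliminated by the affine equation
    -- and the dual form vanishes identically.
    by_cases hz : z 2 = 0
    · have : z 1 ^ 3 = 0 := by rw [hz] at hW; linear_combination -hW
      rw [pow_eq_zero_iff three_ne_zero] at this
      rw [hz, this]; ring
    · obtain ⟨X, hX⟩ : ∃ X, z 1 = X * z 2 := ⟨z 1 / z 2, by field_simp⟩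
      obtain ⟨Y, hY⟩ : ∃ Y, z 0 = Y * z 2 := ⟨z 0 / z 2, by field_simp⟩
      rw [hX, hY] at hW ⊢
      obtain rfl : b = Y ^ 2 - X ^ 3 - a * X := by
        apply mul_left_cancel₀ (pow_ne_zero 3 hz); linear_combination -hW
      ring

end Dual

/-! ### The curves `t ↦ (y = t x + c(t))`: birationality, pencil and even contact -/

section Curves

open Polynomial

variable {k : Type*} [Field k]

/-- A parametrization is birational onto its image as soon as the parameter is a ratio of linear
forms in the coordinates. -/
theorem isProper_of_mulVec (P : Matrix (Fin 3) (Fin 3) k) (w : Fin 3 → k[X]) {i j : Fin 3} {u : k}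
    (hu : u ≠ 0) (hi : (P.map C *ᵥ w) i ≠ 0)
    (hj : (P.map C *ᵥ w) j = C u * X * (P.map C *ᵥ w) i) : IsProper w := by
  rw [IsProper]
  set E := IntermediateField.adjoin k
    (Set.range fun ij : Fin 3 × Fin 3 =>
      (algebraMap k[X] (RatFunc k) (w ij.1) / algebraMap k[X] (RatFunc k) (w ij.2)))
  set ι := algebraMap k[X] (RatFunc k)
  have hι : Function.Injective ι := IsFractionRing.injective k[X] (RatFunc k)
  obtain ⟨l, hl⟩ : ∃ l, w l ≠ 0 := by
    by_contra! h
    apply hi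
    simp [Matrix.mulVec, dotProduct, h]
  have hl' : ι (w l) ≠ 0 := (map_ne_zero_iff ι hι).mpr hl
  have hE : ∀ i, ι ((P.map C *ᵥ w) i) / ι (w l) ∈ E := by
    intro i
    have : ι ((P.map C *ᵥ w) i) / ι (w l) =
        ∑ j, algebraMap k (RatFunc k) (P i j) * (ι (w j) / ι (w l)) := by
      simp only [Matrix.mulVec, dotProduct, map_sum, Finset.sum_div, map_mul, Matrix.map_apply,
        mul_div_assoc]
      refine Finset.sum_congr rfl fun j _ => ?_
      congr 1
    rw [this]
    refine sum_mem fun j _ => mul_mem (E.algebraMap_mem _) ?_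
    exact IntermediateField.subset_adjoin _ _ ⟨(j, l), rfl⟩
  have hi' : ι ((P.map C *ᵥ w) i) ≠ 0 := (map_ne_zero_iff ι hι).mpr hi
  have hX : RatFunc.X ∈ E := by
    have h1 := div_mem (hE j) (hE i)
    rw [div_div_div_cancel_right₀ hl', hj, map_mul, mul_div_cancel_right₀ _ hi', map_mul] at h1
    have h2 := mul_mem (E.algebraMap_mem u⁻¹) h1
    have h3 : algebraMap k (RatFunc k) u⁻¹ * (ι (C u) * ι X) = RatFunc.X := by
      have : ι (C u) = algebraMap k (RatFunc k) u := rfl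
      rw [this, ← mul_assoc, ← map_mul, inv_mul_cancel₀ hu, map_one, one_mul]
      exact RatFunc.algebraMap_X
    rwa [h3] at h2
  rw [eq_top_iff, ← RatFunc.adjoin_X]
  exact IntermediateField.adjoin_le_iff.mpr (by simpa using hX)

/-- The cofactor identity for cross products, used to undo the coordinate change in the line joining
two points of the dual plane. -/
theorem mulVec_cross {A : Type*} [CommRing A] (N : Matrix (Fin 3) (Fin 3) A) (u v : Fin 3 → A) :
    N *ᵥ ((Nᵀ *ᵥ u) ⨯₃ (Nᵀ *ᵥ v)) = N.det • (u ⨯₃ v) := by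
  funext i
  fin_cases i <;> simp [Matrix.mulVec, dotProduct, Fin.sum_univ_three, cross_apply,
    Matrix.det_fin_three] <;> ring

/-- The line `y = t x + c`, where `c = A / B`, in the coordinates of `weier a b`. -/
noncomputable def lineVec (c : RatFunc k) : Fin 3 → k[X] := ![-c.denom, X * c.denom, c.num]

theorem mulVec_map_C {M N : Matrix (Fin 3) (Fin 3) k} (hMN : M * N = 1) (v : Fin 3 → k[X]) :
    Mᵀ.map C *ᵥ (Nᵀ.map C *ᵥ v) = v := by
  rw [Matrix.mulVec_mulVec, ← Matrix.map_mul, ← Matrix.transpose_mul, mul_eq_one_comm.mp hMN,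
    Matrix.transpose_one, Matrix.map_one _ (map_zero _) (map_one _), Matrix.one_mulVec]

theorem span_range_mulVec_eq_top {M N : Matrix (Fin 3) (Fin 3) k} (hMN : M * N = 1)
    (c : RatFunc k) : Ideal.span (Set.range (Nᵀ.map C *ᵥ lineVec c)) = ⊤ := by
  set I := Ideal.span (Set.range (Nᵀ.map C *ᵥ lineVec c))
  have h : ∀ i, lineVec c i ∈ I := by
    intro i
    rw [← mulVec_map_C hMN (lineVec c), Matrix.mulVec, dotProduct]
    exact sum_mem fun j _ => I.mul_mem_left _ (Ideal.subset_span (Set.mem_range_self j))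
  obtain ⟨r, s, hrs⟩ := RatFunc.isCoprime_num_denom c
  rw [Ideal.eq_top_iff_one, ← hrs]
  refine add_mem (Ideal.mul_mem_left _ _ (h 2)) (Ideal.mul_mem_left _ _ ?_)
  exact neg_mem_iff.mp (h 0)

/-- The rational curve `t ↦ (y = t x + c(t))` in the dual plane, in arbitrary coordinates. -/
noncomputable def lineCurve {M N : Matrix (Fin 3) (Fin 3) k} (hMN : M * N = 1) (c : RatFunc k) :
    RationalCurve k where
  coord := Nᵀ.map C *ᵥ lineVec c
  coprime := span_range_mulVec_eq_top hMN c
  proper := by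
    refine isProper_of_mulVec Mᵀ _ (i := 0) (j := 1) (u := -1) (by simp) ?_ ?_ <;>
      rw [mulVec_map_C hMN]
    · simpa [lineVec] using c.denom_ne_zero
    · simp [lineVec]

theorem lineCurve_isSectionOfPencil {M N : Matrix (Fin 3) (Fin 3) k} (hMN : M * N = 1)
    (c : RatFunc k) {a b κ : k} (hκ : κ ≠ 0) {p : Fin 3 → k} (hp : N *ᵥ p = ![1, 0, 0]) :
    (lineCurve hMN c).IsSectionOfPencil
      (gradient (MvPolynomial.C κ * subst N (weier a b)) p) := by
  have hid : N.map (algebraMap k k) = N := by ext; simp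
  have hg : (fun i => C (gradient (MvPolynomial.C κ * subst N (weier a b)) p i)) =
      (N.map C)ᵀ *ᵥ ![0, 0, C κ] := by
    rw [gradient_C_mul, gradient_subst, hid, hp, gradient_weier]
    funext i
    simp [Matrix.mulVec, dotProduct, Fin.sum_univ_three]
    ring
  have hdet : N.det ≠ 0 := by
    intro h
    have := congrArg Matrix.det hMN
    rw [Matrix.det_mul, h] at this
    simp at this
  have hdet' : (N.map C).det = C N.det := (RingHom.map_det C N).symm
  rw [RationalCurve.IsSectionOfPencil, hg]
  change IsProper (((N.map C)ᵀ *ᵥ ![0, 0, C κ]) ⨯₃ ((N.map C)ᵀ *ᵥ lineVec c))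
  -- In Weierstrass coordinates the cusp is `(0, 0, κ)`, and its join with the curve has first two
  -- coordinates proportional to `(t, 1)`.
  refine isProper_of_mulVec N _ (i := 1) (j := 0) (u := 1) one_ne_zero ?_ ?_ <;>
    rw [mulVec_cross, hdet']
  · simpa [lineVec, cross_apply] using ⟨hdet, hκ, c.denom_ne_zero⟩
  · simp [lineVec, cross_apply]; ring

theorem rootMultiplicity_mul_sq {κ : Type*} [Field κ] {u : κ} (hu : u ≠ 0) {s : κ[X]} (hs : s ≠ 0)
    (r : κ) : Even ((C u * s ^ 2).rootMultiplicity r) := by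
  have h1 : (C u * s ^ 2) ≠ 0 := mul_ne_zero (C_ne_zero.mpr hu) (pow_ne_zero 2 hs)
  rw [rootMultiplicity_mul h1, rootMultiplicity_C, zero_add, sq,
    rootMultiplicity_mul (mul_ne_zero hs hs)]
  exact Even.add_self _

/-- Clearing denominators multiplies `lineDisc` by `denom⁶`, a square, and a polynomial that is a
square in `k(t)` is a square in `k[t]`. -/
theorem exists_aeval_lineVec (h3 : (3 : k) ≠ 0) {a b : k} {c w : RatFunc k} (hw0 : w ≠ 0)
    (hw : w ^ 2 = -3 * lineDisc (RatFunc.C a) (RatFunc.C b) RatFunc.X c) :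
    ∃ s : k[X], s ≠ 0 ∧ MvPolynomial.aeval (lineVec c) (dualForm a b) = C (-3) * s ^ 2 := by
  set ι := algebraMap k[X] (RatFunc k)
  have hι : Function.Injective ι := IsFractionRing.injective k[X] (RatFunc k)
  have hB : ι c.denom ≠ 0 := (map_ne_zero_iff ι hι).mpr c.denom_ne_zero
  have hc : ι c.num = c * ι c.denom := by
    exact (div_eq_iff hB).mp (RatFunc.num_div_denom c)
  have hX : ι X = RatFunc.X := RatFunc.algebraMap_X
  have hC : ∀ r : k, ι (C r) = RatFunc.C r := RatFunc.algebraMap_C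
  have h3K : (3 : RatFunc k) ≠ 0 := by
    rw [← map_ofNat RatFunc.C 3]; exact (_root_.map_ne_zero _).mpr h3
  have hD : ι (MvPolynomial.aeval (lineVec c) (dualForm a b)) =
      ι c.denom ^ 6 * lineDisc (RatFunc.C a) (RatFunc.C b) RatFunc.X c := by
    rw [aeval_dualForm]
    simp only [lineVec, Matrix.cons_val, algebraMap_eq, map_add, map_mul, map_sub, map_neg, map_pow,
      map_ofNat, hX, hC, hc, lineDisc]
    ring
  obtain ⟨s, hs, hs2⟩ := exists_algebraMap_eq_of_sq_eq (f := ι c.denom ^ 3 * w / 3)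
    (g := C (-3⁻¹) * MvPolynomial.aeval (lineVec c) (dualForm a b)) (by
      change _ = ι _
      rw [map_mul, hD, hC, map_neg, map_inv₀, map_ofNat, div_pow, mul_pow, hw]
      field_simp)
  refine ⟨s, ?_, ?_⟩
  · rintro rfl
    rw [map_zero] at hs
    exact div_ne_zero (mul_ne_zero (pow_ne_zero 3 hB) hw0) h3K hs.symm
  · rw [hs2, ← mul_assoc, ← C_mul, neg_mul_neg, mul_inv_cancel₀ h3, C_1, one_mul]

theorem mulVec_map_ringHom {κ A : Type*} [Field κ] [Algebra k κ] [CommRing A] [Algebra κ A]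
    {M N : Matrix (Fin 3) (Fin 3) k} (hMN : M * N = 1) (Φ : k[X] →+* A)
    (hΦ : ∀ r, Φ (C r) = algebraMap κ A (algebraMap k κ r)) (v : Fin 3 → k[X]) :
    (Mᵀ.map (algebraMap k κ)).map (algebraMap κ A) *ᵥ (fun i => Φ ((Nᵀ.map C *ᵥ v) i)) =
      fun i => Φ (v i) := by
  conv_rhs => rw [← mulVec_map_C hMN v]
  funext i
  simp only [Matrix.mulVec, dotProduct, map_sum, map_mul, Matrix.map_apply, hΦ]

theorem map_aeval_dualForm {κ A : Type*} [Field κ] [Algebra k κ] [CommRing A] [Algebra κ A]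
    (Φ : k[X] →+* A) (hΦ : ∀ r, Φ (C r) = algebraMap κ A (algebraMap k κ r)) (a b : k)
    (v : Fin 3 → k[X]) :
    MvPolynomial.aeval (fun i => Φ (v i)) (dualForm (algebraMap k κ a) (algebraMap k κ b)) =
      Φ (MvPolynomial.aeval v (dualForm a b)) := by
  rw [aeval_dualForm, aeval_dualForm]
  simp only [algebraMap_eq, map_add, map_mul, map_sub, map_neg, map_pow, map_ofNat, hΦ]

theorem eval_mulVec_C {κ : Type*} [Field κ] (P : Matrix (Fin 3) (Fin 3) κ) (v : Fin 3 → κ[X])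
    (r : κ) (j : Fin 3) :
    eval r ((P.map (algebraMap κ κ[X]) *ᵥ v) j) = (P *ᵥ fun i => eval r (v i)) j := by
  simp [Matrix.mulVec, dotProduct, eval_finsetSum]

/-- The restriction of the dual equation is `-3 s²`. Its order is even at each finite point, and
passing to the parameter `1/t` changes the order at infinity by an even number. -/
theorem lineCurve_meetsDualEvenly (h2 : (2 : k) ≠ 0) (h3 : (3 : k) ≠ 0) {a b κ : k}
    (hd : 4 * a ^ 3 + 27 * b ^ 2 ≠ 0) (hκ : κ ≠ 0) {M N : Matrix (Fin 3) (Fin 3) k}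
    (hMN : M * N = 1) {c w : RatFunc k} (hw0 : w ≠ 0)
    (hw : w ^ 2 = -3 * lineDisc (RatFunc.C a) (RatFunc.C b) RatFunc.X c) :
    (lineCurve hMN c).MeetsDualEvenly (MvPolynomial.C κ * subst N (weier a b)) := by
  obtain ⟨s, hs0, hs⟩ := exists_aeval_lineVec h3 hw0 hw
  refine ⟨_, isDualEquation_subst h2 h3 hd hκ hMN, fun τ => ?_⟩
  let E := AlgebraicClosure k
  have h3' : (-3 : E) ≠ 0 := by
    rw [neg_ne_zero, ← map_ofNat (algebraMap k E) 3]; exact (_root_.map_ne_zero _).mpr h3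
  let ι : k[X] →+* E[X] := mapRingHom (algebraMap k E)
  have hι : Function.Injective ι := map_injective _ (algebraMap k E).injective
  have hιs : ι s ≠ 0 := (map_ne_zero_iff ι hι).mpr hs0
  rw [RationalCurve.restrict, aeval_subst]
  induction τ using OnePoint.rec with
  | coe r =>
    let Φ : k[X] →+* E[X] := (taylorAlgHom r : E[X] →ₐ[E] E[X]).toRingHom.comp ι
    have hΦ : ∀ r, Φ (C r) = algebraMap E E[X] (algebraMap k E r) := fun r => by simp [Φ, ι]
    have h1 : (lineCurve hMN c).localCoord (r : OnePoint E) =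
        fun i => Φ ((Nᵀ.map C *ᵥ lineVec c) i) := by
      funext i; rfl
    have hΦs : Φ s ≠ 0 := by
      intro h
      apply hιs
      exact taylor_injective r (by simpa [Φ] using h)
    rw [h1, mulVec_map_ringHom hMN Φ hΦ, map_aeval_dualForm Φ hΦ, hs, map_mul, map_pow, hΦ]
    simp only [map_neg, map_ofNat]
    rw [show (-3 : E[X]) = C (-3) by rw [C_neg]; exact congrArg _ (map_ofNat C 3).symm]
    exact ⟨mul_ne_zero (C_ne_zero.mpr h3') (pow_ne_zero 2 hΦs), rootMultiplicity_mul_sq h3' hΦs 0⟩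
  | infty =>
    set d := (lineCurve hMN c).degree
    set v' := (lineCurve hMN c).localCoord OnePoint.infty
    set D := dualForm (algebraMap k E a) (algebraMap k E b)
    set P := Mᵀ.map (algebraMap k E)
    have hv' : ∀ i, v' i = ι (reflect d ((Nᵀ.map C *ᵥ lineVec c) i)) := fun i => rfl
    have hdeg : ∀ i, ((Nᵀ.map C *ᵥ lineVec c) i).natDegree ≤ d := fun i =>
      Finset.le_sup (f := fun i => ((Nᵀ.map C *ᵥ lineVec c) i).natDegree) (Finset.mem_univ i)
    have hrefl : ∀ (r : E) (hr : r ≠ 0) (m : ℕ) (f : k[X]), f.natDegree ≤ m →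
        eval r (ι (reflect m f)) = r ^ m * eval r⁻¹ (ι f) := by
      intro r hr m f hf
      let _ : Invertible r⁻¹ := ⟨r, mul_inv_cancel₀ hr, inv_mul_cancel₀ hr⟩
      have := eval₂_reflect_mul_pow (algebraMap k E) r⁻¹ m f hf
      simp only [ι, coe_mapRingHom, eval_map]
      rw [← this]
      change _ = r ^ m * (eval₂ _ r _ * _)
      rw [inv_pow, mul_comm (r ^ m), mul_assoc, inv_mul_cancel₀ (pow_ne_zero m hr), mul_one]
    -- With the maximum no bound on the degree of `s` is needed; the compensating power of `X` in
    -- `key` has even exponent, so parities are unaffected.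
    set m := max (3 * d) s.natDegree
    set s' := ι (reflect m s)
    have key : X ^ (2 * (m - 3 * d)) * MvPolynomial.aeval (P.map (algebraMap E E[X]) *ᵥ v') D =
        C (-3) * s' ^ 2 := by
      -- The extra factor `X` makes the identity trivial at `0`, so it is only evaluated where `r⁻¹`
      -- makes sense.
      apply mul_left_cancel₀ (X_ne_zero (R := E))
      refine Polynomial.funext fun r => ?_
      by_cases hr : r = 0
      · simp [hr]
      let Ψ : k[X] →+* E := (evalRingHom r⁻¹).comp ι
      have hΨ : ∀ q, Ψ (C q) = algebraMap E E (algebraMap k E q) := fun q => by simp [Ψ, ι]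
      have e1 : ∀ i, eval r (v' i) = r ^ d * Ψ ((Nᵀ.map C *ᵥ lineVec c) i) := by
        intro i
        rw [hv', hrefl r hr d _ (hdeg i)]; rfl
      have e2 : (fun j => aeval r ((P.map (algebraMap E E[X]) *ᵥ v') j)) =
          fun j => r ^ d * Ψ (lineVec c j) := by
        have e0 := mulVec_map_ringHom hMN Ψ hΨ (lineVec c)
        rw [Algebra.algebraMap_self, RingHom.coe_id, Matrix.map_id] at e0
        funext j
        rw [coe_aeval_eq_eval, eval_mulVec_C]
        simp only [e1]
        have := congrFun (Matrix.mulVec_smul P (r ^ d) fun i => Ψ ((Nᵀ.map C *ᵥ lineVec c) i)) j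
        rw [e0] at this
        exact this
      have e3 : eval r (MvPolynomial.aeval (P.map (algebraMap E E[X]) *ᵥ v') D) =
          r ^ (6 * d) * Ψ (MvPolynomial.aeval (lineVec c) (dualForm a b)) := by
        rw [← coe_aeval_eq_eval, MvPolynomial.comp_aeval_apply, e2,
          ← map_aeval_dualForm Ψ hΨ, aeval_dualForm, aeval_dualForm]
        ring
      have e4 : eval r s' = r ^ m * Ψ s := hrefl r hr m s (le_max_right _ _)
      have e5 : 2 * (m - 3 * d) + 6 * d = 2 * m := by
        have : 3 * d ≤ m := le_max_left _ _
        omega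
      have e6 : r ^ (2 * (m - 3 * d)) * r ^ (6 * d) = (r ^ m) ^ 2 := by
        rw [← pow_add, e5, mul_comm, pow_mul]
      simp only [eval_mul, eval_pow, eval_X, eval_C, e3, e4, hs, map_mul, map_pow, hΨ]
      rw [show algebraMap E E (algebraMap k E (-3)) = -3 by
        rw [map_neg, map_ofNat]; rfl]
      linear_combination (r * -3 * Ψ s ^ 2) * e6
    have hs' : s' ≠ 0 := by
      refine (map_ne_zero_iff ι hι).mpr ?_
      rwa [Ne, reflect_eq_zero_iff]
    have hne : MvPolynomial.aeval (P.map (algebraMap E E[X]) *ᵥ v') D ≠ 0 := by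
      intro h
      rw [h, mul_zero] at key
      exact mul_ne_zero (C_ne_zero.mpr h3') (pow_ne_zero 2 hs') key.symm
    refine ⟨hne, ?_⟩
    have heven := rootMultiplicity_mul_sq h3' hs' 0
    rw [← key, rootMultiplicity_mul (mul_ne_zero (pow_ne_zero _ X_ne_zero) hne)] at heven
    have hX : Even ((X ^ (2 * (m - 3 * d)) : E[X]).rootMultiplicity 0) := by
      have := rootMultiplicity_X_sub_C_pow (0 : E) (2 * (m - 3 * d))
      rw [C_0, sub_zero] at this
      rw [this]
      exact even_two_mul _
    exact (Nat.even_add.mp heven).mp hX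

end Curves

/-! ### The curve determines `c` -/

section Carrier

open Polynomial

variable {k : Type*} [Field k]

theorem natDegree_mulVec_map_C_le (P : Matrix (Fin 3) (Fin 3) k) {u : Fin 3 → k[X]} {d : ℕ}
    (hu : ∀ i, (u i).natDegree ≤ d) (j : Fin 3) : ((P.map C *ᵥ u) j).natDegree ≤ d := by
  simp only [Matrix.mulVec, dotProduct, Matrix.map_apply]
  exact natDegree_sum_le_of_forall_le _ _ fun i _ => (natDegree_C_mul_le _ _).trans (hu i)

/-- The coordinate `X * denom` forces the inequality to be strict. Consequently the point at
infinity of the parametrization is a line with vanishing `Y`-coefficient. -/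
theorem natDegree_denom_lt_degree_lineCurve {M N : Matrix (Fin 3) (Fin 3) k} (hMN : M * N = 1)
    (c : RatFunc k) : c.denom.natDegree < (lineCurve hMN c).degree := by
  have h1 : (X * c.denom).natDegree = c.denom.natDegree + 1 := by
    rw [mul_comm, natDegree_mul_X c.denom_ne_zero]
  have h2 : X * c.denom = (Mᵀ.map C *ᵥ (lineCurve hMN c).coord) 1 :=
    (congrFun (mulVec_map_C hMN (lineVec c)) 1).symm
  rw [Nat.lt_iff_add_one_le, ← h1, h2]
  exact natDegree_mulVec_map_C_le _ (fun i => Finset.le_sup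
    (f := fun i => ((lineCurve hMN c).coord i).natDegree) (Finset.mem_univ i)) 1

theorem mulVec_localCoord_coe {M N : Matrix (Fin 3) (Fin 3) k} (hMN : M * N = 1) (c : RatFunc k)
    (r : AlgebraicClosure k) (j : Fin 3) :
    (Mᵀ.map (algebraMap k (AlgebraicClosure k)) *ᵥ
      fun i => eval 0 ((lineCurve hMN c).localCoord (r : OnePoint (AlgebraicClosure k)) i)) j =
      aeval r (lineVec c j) := by
  have h := mulVec_map_ringHom (κ := AlgebraicClosure k) hMN
    (aeval r : k[X] →ₐ[k] AlgebraicClosure k).toRingHom (fun s => by simp) (lineVec c)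
  rw [Algebra.algebraMap_self, RingHom.coe_id, Matrix.map_id] at h
  have e : (fun i => eval 0
      ((lineCurve hMN c).localCoord (r : OnePoint (AlgebraicClosure k)) i)) =
      fun i => (aeval r : k[X] →ₐ[k] AlgebraicClosure k).toRingHom
        ((Nᵀ.map C *ᵥ lineVec c) i) := by
    funext i
    change eval 0 (taylor r (Polynomial.map _ ((Nᵀ.map C *ᵥ lineVec c) i))) = aeval r _
    rw [taylor_eval, zero_add, eval_map_algebraMap]
  rw [e]
  exact congrFun h j

theorem mulVec_localCoord_infty {M N : Matrix (Fin 3) (Fin 3) k} (hMN : M * N = 1)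
    (c : RatFunc k) :
    (Mᵀ.map (algebraMap k (AlgebraicClosure k)) *ᵥ
      fun i => eval 0 ((lineCurve hMN c).localCoord OnePoint.infty i)) 0 = 0 := by
  set d := (lineCurve hMN c).degree with hd
  have e : ∀ i, eval 0 ((lineCurve hMN c).localCoord OnePoint.infty i) =
      algebraMap k (AlgebraicClosure k) (((lineCurve hMN c).coord i).coeff d) := by
    intro i
    change eval 0 (Polynomial.map _ (reflect _ _)) = _
    rw [← coeff_zero_eq_eval_zero, coeff_map, coeff_reflect, revAt_zero]
  have h := congrArg (fun q => coeff q d) (congrFun (mulVec_map_C hMN (lineVec c)) 0)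
  change coeff ((Mᵀ.map C *ᵥ (lineCurve hMN c).coord) 0) d = coeff (lineVec c 0) d at h
  have h0 : (lineVec c 0).coeff d = 0 := by
    simp only [lineVec, Matrix.cons_val_zero, coeff_neg, neg_eq_zero]
    exact coeff_eq_zero_of_natDegree_lt (natDegree_denom_lt_degree_lineCurve hMN c)
  simp only [h0, Matrix.mulVec, dotProduct, finsetSum_coeff, Matrix.map_apply, coeff_C_mul] at h
  simp only [Matrix.mulVec, dotProduct, e, Matrix.map_apply, ← map_mul, ← map_sum]
  rw [h, map_zero]

/-- The slope of a line is its parameter, so a non-vertical line common to both curves has the same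
parameter on each and the values of `c` and `c'` agree there. This holds at every `r` that is not a
pole of `c`. -/
theorem eq_of_carrier_lineCurve_eq {M N : Matrix (Fin 3) (Fin 3) k} (hMN : M * N = 1)
    {c c' : RatFunc k} (h : (lineCurve hMN c).carrier = (lineCurve hMN c').carrier) : c = c' := by
  let E := AlgebraicClosure k
  have key : ∀ r : E, aeval r (c.denom * (c.num * c'.denom - c'.num * c.denom)) = 0 := by
    intro r
    by_cases hr : aeval r c.denom = 0
    · rw [map_mul, hr, zero_mul]
    have hu := mulVec_localCoord_coe hMN c r
    have hne : (fun i => eval 0 ((lineCurve hMN c).localCoord (r : OnePoint E) i)) ≠ 0 := by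
      intro h0
      have := hu 0
      rw [h0, Matrix.mulVec_zero] at this
      simp only [lineVec, Matrix.cons_val_zero, map_neg, Pi.zero_apply] at this
      exact hr (neg_eq_zero.mp this.symm)
    have hmem : Projectivization.mk E _ hne ∈ (lineCurve hMN c).carrier := ⟨r, hne, rfl⟩
    rw [h] at hmem
    obtain ⟨τ, hτ, e⟩ := hmem
    obtain ⟨s, hs⟩ := (Projectivization.mk_eq_mk_iff' E _ _ hne hτ).mp e
    have hs' : ∀ j, s * (Mᵀ.map (algebraMap k E) *ᵥ
        fun i => eval 0 ((lineCurve hMN c').localCoord τ i)) j = aeval r (lineVec c j) := by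
      intro j
      rw [← hu j, ← hs, Matrix.mulVec_smul]
      rfl
    induction τ using OnePoint.rec with
    | infty =>
      have := hs' 0
      rw [mulVec_localCoord_infty] at this
      simp only [lineVec, Matrix.cons_val_zero, map_neg, mul_zero] at this
      exact absurd (neg_eq_zero.mp this.symm) hr
    | coe r' =>
      have h0 := hs' 0
      have h1 := hs' 1
      have h2 := hs' 2
      rw [mulVec_localCoord_coe] at h0 h1 h2
      simp only [lineVec, Matrix.cons_val, map_neg, map_mul, aeval_X] at h0 h1 h2
      have hrr : r' = r := by
        apply mul_right_cancel₀ hr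
        linear_combination h1 + r' * h0
      subst hrr
      simp only [map_mul, map_sub]
      linear_combination (-aeval r' c.denom * aeval r' c'.denom) * h2 -
        aeval r' c.denom * aeval r' c'.num * h0
  have hz : c.denom * (c.num * c'.denom - c'.num * c.denom) = 0 := by
    apply map_injective (algebraMap k E) (algebraMap k E).injective
    refine Polynomial.funext fun r => ?_
    rw [eval_map_algebraMap, key r, Polynomial.map_zero, eval_zero]
  have hz' := sub_eq_zero.mp ((mul_eq_zero.mp hz).resolve_left c.denom_ne_zero)
  have hι : Function.Injective (algebraMap k[X] (RatFunc k)) :=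
    IsFractionRing.injective k[X] (RatFunc k)
  rw [← RatFunc.num_div_denom c, ← RatFunc.num_div_denom c',
    div_eq_div_iff ((map_ne_zero_iff _ hι).mpr c.denom_ne_zero)
      ((map_ne_zero_iff _ hι).mpr c'.denom_ne_zero), ← map_mul, hz', map_mul]

end Carrier

/-! ### The cubic of abscissas: no rational root, and Cardano's formula -/

section Roots

open Polynomial

variable {k : Type*} [Field k]

theorem exists_C_eq_of_sq_eq_C {y : RatFunc k} {r : k} (h : y ^ 2 = RatFunc.C r) :
    ∃ y₀, y = RatFunc.C y₀ ∧ y₀ ^ 2 = r := by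
  obtain ⟨s, rfl, hs⟩ := exists_algebraMap_eq_of_sq_eq (g := C r)
    (by rw [h]; exact (RatFunc.algebraMap_C r).symm)
  have hn : s.natDegree = 0 := by
    have := congrArg natDegree hs
    rw [natDegree_pow, natDegree_C] at this
    omega
  obtain ⟨y₀, rfl⟩ := natDegree_eq_zero.mp hn
  refine ⟨y₀, RatFunc.algebraMap_C y₀, ?_⟩
  rw [← C_pow] at hs
  exact C_injective hs

/-- A line through a constant point of the curve and with slope `t` never satisfies the condition
on the discriminant. -/
theorem quartic_ne_sq (h2 : (2 : k) ≠ 0) (h3 : (3 : k) ≠ 0) {a b x y : k}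
    (hd : 4 * a ^ 3 + 27 * b ^ 2 ≠ 0) (hxy : y ^ 2 = x ^ 3 + a * x + b) (s : k[X]) :
    s ^ 2 ≠ C (-3) * X ^ 4 + C (18 * x) * X ^ 2 + C (-24 * y) * X + C (9 * x ^ 2 + 12 * a) := by
  intro hs
  have hdeg : s.natDegree ≤ 2 := by
    have h1 : (s ^ 2).natDegree ≤ 4 := by rw [hs]; compute_degree
    rw [natDegree_pow] at h1
    omega
  obtain ⟨α, β, γ, rfl⟩ : ∃ α β γ, s = C α * X ^ 2 + C β * X + C γ :=
    ⟨_, _, _, eq_quadratic_of_degree_le_two (degree_le_of_natDegree_le hdeg)⟩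
  have hs' : C (α ^ 2) * X ^ 4 + C (2 * α * β) * X ^ 3 + C (2 * α * γ + β ^ 2) * X ^ 2 +
      C (2 * β * γ) * X + C (γ ^ 2) =
      C (-3) * X ^ 4 + C (18 * x) * X ^ 2 + C (-24 * y) * X + C (9 * x ^ 2 + 12 * a) := by
    rw [← hs]
    simp only [C_mul, C_add, C_pow, C_ofNat]
    ring
  have c4 := congrArg (fun q => coeff q 4) hs'
  have c3 := congrArg (fun q => coeff q 3) hs'
  have c2 := congrArg (fun q => coeff q 2) hs'
  have c1 := congrArg (fun q => coeff q 1) hs'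
  have c0 := congrArg (fun q => coeff q 0) hs'
  simp only [coeff_add, coeff_C_mul, coeff_X_pow, coeff_X, coeff_C] at c4 c3 c2 c1 c0
  norm_num at c4 c3 c2 c1 c0
  have hα : α ≠ 0 := by
    rintro rfl
    apply h3
    linear_combination c4
  have hβ : β = 0 := c3.resolve_left (by simp [h2, hα])
  subst hβ
  have hy : y = 0 := by
    have h := natCast_ne_zero_of_two_three h2 h3 3 1
    apply mul_left_cancel₀ h
    linear_combination c1
  -- With `α² = -3` and `αγ = 9x`, comparing `γ²` with `9x² + 12a` gives the singular cubic `(x,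
  -- 0)`-node relation `a = -3x²`, and then `b = 2x³`.
  have ha : a = -3 * x ^ 2 := by
    have h := natCast_ne_zero_of_two_three h2 h3 4 2
    apply mul_left_cancel₀ h
    linear_combination 4 * γ ^ 2 * c4 - 12 * c0 - (2 * α * γ + 18 * x) * c2
  apply hd
  subst hy
  have hb : b = 2 * x ^ 3 := by linear_combination -hxy - x * ha
  rw [ha, hb]
  ring

/-- The third point of intersection is not rational. -/
theorem cubic_ne_zero (h2 : (2 : k) ≠ 0) (h3 : (3 : k) ≠ 0) {a b : k}
    (hd : 4 * a ^ 3 + 27 * b ^ 2 ≠ 0) {c w : RatFunc k}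
    (hw : w ^ 2 = -3 * lineDisc (RatFunc.C a) (RatFunc.C b) RatFunc.X c) (x : RatFunc k) :
    x ^ 3 - RatFunc.X ^ 2 * x ^ 2 + (RatFunc.C a - 2 * RatFunc.X * c) * x +
      (RatFunc.C b - c ^ 2) ≠ 0 := by
  intro hx
  have hxy : (RatFunc.X * x + c) ^ 2 = x ^ 3 + RatFunc.C a * x + RatFunc.C b := by
    linear_combination -hx
  obtain ⟨x₀, rfl⟩ := exists_C_eq_of_weierstrass h2 hd hxy
  simp only [← map_pow, ← map_mul, ← map_add] at hxy
  obtain ⟨y₀, hy, hxy₀⟩ := exists_C_eq_of_sq_eq_C (r := x₀ ^ 3 + a * x₀ + b) (by rw [hxy])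
  set t : RatFunc k := RatFunc.X with ht
  have hc : c = RatFunc.C y₀ - t * RatFunc.C x₀ := by linear_combination hy
  have hb : RatFunc.C b = RatFunc.C y₀ ^ 2 - RatFunc.C x₀ ^ 3 - RatFunc.C a * RatFunc.C x₀ := by
    simp only [← map_pow, ← map_mul, ← map_sub]
    congr 1
    linear_combination -hxy₀
  -- `l` is the derivative of the cubic at its root `x₀`. The discriminant is `l²` times that of the
  -- residual quadratic, and the latter times `-3` is the quartic of `quartic_ne_sq`.
  set l : RatFunc k := 3 * RatFunc.C x₀ ^ 2 + RatFunc.C a - 2 * t * RatFunc.C y₀ with hl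
  have hdisc : lineDisc (RatFunc.C a) (RatFunc.C b) t c = (t ^ 4 - 6 * RatFunc.C x₀ * t ^ 2 +
      8 * RatFunc.C y₀ * t - 3 * RatFunc.C x₀ ^ 2 - 4 * RatFunc.C a) * l ^ 2 := by
    rw [lineDisc, hb, hc, hl]
    ring
  have hι : Function.Injective (algebraMap k[X] (RatFunc k)) :=
    IsFractionRing.injective k[X] (RatFunc k)
  have hX : algebraMap k[X] (RatFunc k) X = t := RatFunc.algebraMap_X
  have hC : ∀ r : k, algebraMap k[X] (RatFunc k) (C r) = RatFunc.C r := RatFunc.algebraMap_C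
  have hl0 : l ≠ 0 := by
    intro h
    have h' : C (3 * x₀ ^ 2 + a) + C (-2 * y₀) * X = (0 : k[X]) := by
      apply hι
      rw [map_zero, ← h, hl]
      simp only [map_add, map_mul, hX, hC, map_neg, map_pow, map_ofNat]
      ring
    have c1 := congrArg (fun q => coeff q 1) h'
    have c0 := congrArg (fun q => coeff q 0) h'
    simp only [coeff_add, coeff_C_mul, coeff_X, coeff_C, coeff_zero] at c1 c0
    norm_num at c1 c0
    have hy₀ : y₀ = 0 := c1.resolve_left h2
    subst hy₀
    have hb' : b = 2 * x₀ ^ 3 := by linear_combination -hxy₀ - x₀ * c0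
    apply hd
    rw [hb']
    linear_combination 4 * (a ^ 2 - 3 * x₀ ^ 2 * a + 9 * x₀ ^ 4) * c0
  obtain ⟨s, -, hs⟩ := exists_algebraMap_eq_of_sq_eq (f := w / l)
    (g := C (-3) * X ^ 4 + C (18 * x₀) * X ^ 2 + C (-24 * y₀) * X + C (9 * x₀ ^ 2 + 12 * a)) (by
      rw [div_pow, hw, hdisc, ← mul_assoc, mul_div_cancel_right₀ _ (pow_ne_zero 2 hl0)]
      simp only [map_add, map_mul, hX, hC, map_neg, map_pow, map_ofNat]
      ring)
  exact quartic_ne_sq h2 h3 hd hxy₀ s hs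

variable {K : Type*} [Field K]

/-- The depressed form of the cubic for the abscissas of the points on `y = t x + c`. -/
def depP (a t c : K) : K := a - 2 * t * c - t ^ 4 / 3

/-- The constant coefficient of the depressed cubic. -/
def depQ (a b t c : K) : K := b - c ^ 2 + (a - 2 * t * c) * t ^ 2 / 3 - 2 * t ^ 6 / 27

theorem depressed_cubic (h3 : (3 : K) ≠ 0) (a b t c z : K) :
    (z + t ^ 2 / 3) ^ 3 - t ^ 2 * (z + t ^ 2 / 3) ^ 2 + (a - 2 * t * c) * (z + t ^ 2 / 3) +
      (b - c ^ 2) = z ^ 3 + depP a t c * z + depQ a b t c := by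
  have h27 : (27 : K) ≠ 0 := by rw [show (27 : K) = 3 ^ 3 by norm_num]; exact pow_ne_zero 3 h3
  rw [depP, depQ]
  field_simp
  ring

theorem lineDisc_eq_depressed (h3 : (3 : K) ≠ 0) (a b t c : K) :
    lineDisc a b t c = -4 * depP a t c ^ 3 - 27 * depQ a b t c ^ 2 := by
  have h27 : (27 : K) ≠ 0 := by rw [show (27 : K) = 3 ^ 3 by norm_num]; exact pow_ne_zero 3 h3
  rw [depP, depQ, lineDisc]
  field_simp
  ring

/-- A cubic with zero discriminant has a multiple root, rational in the coefficients: `-3Q / (2P)`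
in depressed form, or `0` if `P = 0`. -/
theorem exists_cubic_eq_zero_of_lineDisc_eq_zero (h2 : (2 : K) ≠ 0) (h3 : (3 : K) ≠ 0)
    {a b t c : K} (h : lineDisc a b t c = 0) :
    ∃ x : K, x ^ 3 - t ^ 2 * x ^ 2 + (a - 2 * t * c) * x + (b - c ^ 2) = 0 := by
  rw [lineDisc_eq_depressed h3] at h
  by_cases hP : depP a t c = 0
  · refine ⟨0 + t ^ 2 / 3, ?_⟩
    have hQ : depQ a b t c = 0 := by
      rw [hP] at h
      have : (3 : K) ^ 3 * depQ a b t c ^ 2 = 0 := by linear_combination -h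
      exact pow_eq_zero_iff two_ne_zero |>.mp
        ((mul_eq_zero.mp this).resolve_left (pow_ne_zero 3 h3))
    rw [depressed_cubic h3, hP, hQ]
    ring
  · refine ⟨-3 * depQ a b t c / (2 * depP a t c) + t ^ 2 / 3, ?_⟩
    rw [depressed_cubic h3]
    field_simp
    linear_combination (depQ a b t c) * h

/-- Cardano's formula: if `-3` times the discriminant is a nonzero square, the cubic has a root in
an extension by one cubic radical. -/
theorem exists_cubic_radical 
    {Ω : Type*} [Field Ω] [IsAlgClosed Ω] [Algebra K Ω] {a b t c w : K} (h2 : (2 : K) ≠ 0)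
    (h3 : (3 : K) ≠ 0) (hw0 : w ≠ 0) (hw : w ^ 2 = -3 * lineDisc a b t c) :
    ∃ (R : K) (ρ x : Ω), ρ ^ 3 = algebraMap K Ω R ∧ x ∈ IntermediateField.adjoin K {ρ} ∧
      x ^ 3 - algebraMap K Ω t ^ 2 * x ^ 2 + algebraMap K Ω (a - 2 * t * c) * x +
        algebraMap K Ω (b - c ^ 2) = 0 := by
  rw [lineDisc_eq_depressed h3] at hw
  set P := depP a t c
  set Q := depQ a b t c
  -- Cardano's resolvent: `Q²/4 + P³/27 = -disc/108 = (w/18)²`, so `-Q/2 ± w/18` lie in `K`.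
  have hR : ∀ u : K, u ^ 2 = w ^ 2 → (-Q / 2 + u / 18) ^ 2 + Q * (-Q / 2 + u / 18) = P ^ 3 / 27 := by
    intro u hu
    have h27 : (27 : K) ≠ 0 := by rw [show (27 : K) = 3 ^ 3 by norm_num]; exact pow_ne_zero 3 h3
    have h18 : (18 : K) ≠ 0 := by
      rw [show (18 : K) = 2 * 3 ^ 2 by norm_num]; exact mul_ne_zero h2 (pow_ne_zero 2 h3)
    rw [hw] at hu
    field_simp
    linear_combination 108 * hu
  -- The two resolvent roots differ by `w/9 ≠ 0`, so one of them is nonzero. This allows division by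
  -- `ρ`.
  obtain ⟨R, hR0, hR⟩ : ∃ R : K, R ≠ 0 ∧ R ^ 2 + Q * R = P ^ 3 / 27 := by
    by_cases h : -Q / 2 + w / 18 = 0
    · refine ⟨-Q / 2 + -w / 18, fun h' => hw0 ?_, hR (-w) (by ring)⟩
      have h18 : (18 : K) ≠ 0 := by
        rw [show (18 : K) = 2 * 3 ^ 2 by norm_num]; exact mul_ne_zero h2 (pow_ne_zero 2 h3)
      have : 2 * (w / 18) = 0 := by linear_combination h - h'
      exact (div_eq_zero_iff.mp ((mul_eq_zero.mp this).resolve_left h2)).resolve_right h18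
    · exact ⟨_, h, hR w rfl⟩
  obtain ⟨ρ, hρ⟩ := IsAlgClosed.exists_pow_nat_eq (algebraMap K Ω R) (n := 3) (by norm_num)
  have hρ0 : ρ ≠ 0 := by
    rintro rfl
    rw [zero_pow (by norm_num)] at hρ
    exact hR0 ((map_eq_zero _).mp hρ.symm)
  have h3' : (3 : Ω) ≠ 0 := by rw [← map_ofNat (algebraMap K Ω) 3]; exact (_root_.map_ne_zero _).mpr h3
  have hmem : ρ ∈ IntermediateField.adjoin K {ρ} := IntermediateField.mem_adjoin_simple_self K ρ
  refine ⟨R, ρ, (ρ - algebraMap K Ω P / (3 * ρ)) + algebraMap K Ω t ^ 2 / 3, hρ, ?_, ?_⟩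
  · have h3m : (3 : Ω) ∈ IntermediateField.adjoin K {ρ} := ofNat_mem _ 3
    exact add_mem (sub_mem hmem (div_mem (IntermediateField.algebraMap_mem _ _) (mul_mem h3m hmem)))
      (div_mem (pow_mem (IntermediateField.algebraMap_mem _ _) 2) h3m)
  · have hdP : depP (algebraMap K Ω a) (algebraMap K Ω t) (algebraMap K Ω c) = algebraMap K Ω P := by
      simp only [P, depP, map_sub, map_mul, map_pow, map_div₀, map_ofNat]
    have hdQ : depQ (algebraMap K Ω a) (algebraMap K Ω b) (algebraMap K Ω t) (algebraMap K Ω c) =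
        algebraMap K Ω Q := by
      simp only [Q, depQ, map_add, map_sub, map_mul, map_pow, map_div₀, map_ofNat]
    have := depressed_cubic h3' (algebraMap K Ω a) (algebraMap K Ω b) (algebraMap K Ω t)
      (algebraMap K Ω c) (ρ - algebraMap K Ω P / (3 * ρ))
    simp only [map_sub, map_mul, map_pow, map_ofNat]
    rw [this, hdP, hdQ]
    have hR' := congrArg (algebraMap K Ω) hR
    simp only [map_add, map_mul, map_pow, map_div₀, map_ofNat, ← hρ] at hR'
    have h27 : (27 : Ω) ≠ 0 := by rw [show (27 : Ω) = 3 ^ 3 by norm_num]; exact pow_ne_zero 3 h3'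
    rw [eq_div_iff h27] at hR'
    field_simp
    linear_combination hR'

end Roots

/-! ### Pseudo-parameterizations and their inequivalence -/

section Param

open Polynomial

variable {k : Type*} [Field k]

/-- A root of an irreducible monic cubic with transcendental trace is transcendental. -/
theorem transcendental_of_cubic {K Ω : Type*} [Field K] [Field Ω] [Algebra k K] [Algebra K Ω]
    [Algebra k Ω] [IsScalarTower k K Ω] {u v w : K} (hu : Transcendental k u)
    (hroot : ∀ x : K, x ^ 3 - u * x ^ 2 + v * x + w ≠ 0) {x : Ω}
    (hx : x ^ 3 - algebraMap K Ω u * x ^ 2 + algebraMap K Ω v * x + algebraMap K Ω w = 0) :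
    Transcendental k x := by
  intro halg
  set g : K[X] := X ^ 3 - C u * X ^ 2 + C v * X + C w with hg
  have hdeg : g.natDegree = 3 := by rw [hg]; compute_degree!
  have hmon : g.Monic := by rw [hg]; monicity!
  have hirr : Irreducible g := by
    rw [hmon.irreducible_iff_roots_eq_zero_of_degree_le_three (by omega) (by omega),
      Multiset.eq_zero_iff_forall_notMem]
    intro r hr
    apply hroot r
    simpa [hg] using (mem_roots'.mp hr).2
  have hgx : aeval x g = 0 := by simpa [hg] using hx
  have hmin : g = minpoly K x := minpoly.eq_of_irreducible_of_monic hirr hgx hmon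
  have hdvd : g ∣ (minpoly k x).map (algebraMap k K) := by
    rw [hmin]
    exact minpoly.dvd_map_of_isScalarTower k K x
  -- A monic factor over `K` of a monic polynomial over `k` has coefficients integral over `k`; here
  -- the coefficient is `-u`, which is transcendental.
  have hint : IsIntegral k (g.coeff 2) := by
    obtain ⟨q, hq⟩ := integralClosure.mem_lifts_of_monic_of_dvd_map K
      (minpoly.monic halg.isIntegral) hmon hdvd
    rw [← hq]
    rw [coe_mapRingHom, coeff_map]
    exact (q.coeff 2).2
  have hcoeff : g.coeff 2 = -u := by simp [hg]
  rw [hcoeff] at hint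
  apply hu
  simpa using hint.neg.isAlgebraic

theorem algEquiv_apply_eq_of_apply_X {φ : RatFunc k ≃ₐ[k] RatFunc k}
    (h : φ RatFunc.X = RatFunc.X) (f : RatFunc k) : φ f = f := by
  have hp : ∀ q : k[X], φ (algebraMap k[X] (RatFunc k) q) = algebraMap k[X] (RatFunc k) q := by
    intro q
    have : ((φ : RatFunc k →ₐ[k] RatFunc k).comp (IsScalarTower.toAlgHom k k[X] (RatFunc k))) =
        IsScalarTower.toAlgHom k k[X] (RatFunc k) := by
      apply Polynomial.algHom_ext
      simpa [RatFunc.algebraMap_X] using h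
    exact congrArg (fun ψ : k[X] →ₐ[k] RatFunc k => ψ q) this
  rw [← RatFunc.num_div_denom f, map_div₀, hp, hp]

/-- The point with abscissa `x` on the line `y = t x + c`, in the coordinates of `weier a b`. -/
noncomputable def pointVec (c : RatFunc k) (x : AlgebraicClosure (RatFunc k)) :
    Fin 3 → AlgebraicClosure (RatFunc k) :=
  ![algebraMap (RatFunc k) _ RatFunc.X * x + algebraMap (RatFunc k) _ c, x, 1]

theorem mulVec_map_mulVec_map {A : Type*} [CommRing A] [Algebra k A]
    {M N : Matrix (Fin 3) (Fin 3) k} (hMN : M * N = 1) (v : Fin 3 → A) :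
    N.map (algebraMap k A) *ᵥ (M.map (algebraMap k A) *ᵥ v) = v := by
  rw [Matrix.mulVec_mulVec, ← Matrix.map_mul, mul_eq_one_comm.mp hMN,
    Matrix.map_one _ (map_zero _) (map_one _), Matrix.one_mulVec]

theorem aeval_mulVec_pointVec {a b κ : k} {M N : Matrix (Fin 3) (Fin 3) k} (hMN : M * N = 1)
    {c : RatFunc k} {x : AlgebraicClosure (RatFunc k)}
    (hx : x ^ 3 - algebraMap (RatFunc k) _ (RatFunc.X ^ 2) * x ^ 2 +
      algebraMap (RatFunc k) _ (RatFunc.C a - 2 * RatFunc.X * c) * x +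
      algebraMap (RatFunc k) _ (RatFunc.C b - c ^ 2) = 0) :
    MvPolynomial.aeval
      (M.map (algebraMap k (AlgebraicClosure (RatFunc k))) *ᵥ pointVec c x)
      (MvPolynomial.C κ * subst N (weier a b)) = 0 := by
  have hC : ∀ r : k, algebraMap k (AlgebraicClosure (RatFunc k)) r =
      algebraMap (RatFunc k) _ (RatFunc.C r) := fun r =>
    IsScalarTower.algebraMap_apply k (RatFunc k) (AlgebraicClosure (RatFunc k)) r
  rw [map_mul, aeval_subst, mulVec_map_mulVec_map hMN, aeval_weier]
  apply mul_eq_zero_of_right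
  simp only [map_sub, map_mul, map_pow, map_ofNat] at hx
  simp only [pointVec, Matrix.cons_val, hC]
  linear_combination -hx

theorem dotProduct_lineCurve_pointVec {M N : Matrix (Fin 3) (Fin 3) k} (hMN : M * N = 1)
    (c : RatFunc k) (x : AlgebraicClosure (RatFunc k)) :
    ∑ i, algebraMap (RatFunc k) (AlgebraicClosure (RatFunc k))
      (algebraMap k[X] (RatFunc k) ((lineCurve hMN c).coord i)) *
      (M.map (algebraMap k (AlgebraicClosure (RatFunc k))) *ᵥ pointVec c x) i = 0 := by
  let Φ : k[X] →+* AlgebraicClosure (RatFunc k) :=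
    (algebraMap (RatFunc k) _).comp (algebraMap k[X] (RatFunc k))
  have hΦ : ∀ r, Φ (C r) = algebraMap k (AlgebraicClosure (RatFunc k)) r := by
    intro r
    rw [IsScalarTower.algebraMap_apply k (RatFunc k) (AlgebraicClosure (RatFunc k)) r]
    exact congrArg (algebraMap (RatFunc k) _) (RatFunc.algebraMap_C r)
  have h1 : (fun i => Φ ((lineCurve hMN c).coord i)) =
      (N.map (algebraMap k (AlgebraicClosure (RatFunc k))))ᵀ *ᵥ fun i => Φ (lineVec c i) := by
    funext i
    change Φ ((Nᵀ.map C *ᵥ lineVec c) i) = _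
    simp only [Matrix.mulVec, dotProduct, map_sum, map_mul, Matrix.map_apply,
      Matrix.transpose_apply, hΦ]
  change (fun i => Φ ((lineCurve hMN c).coord i)) ⬝ᵥ _ = 0
  rw [h1, Matrix.mulVec_transpose, ← Matrix.dotProduct_mulVec, mulVec_map_mulVec_map hMN]
  have hB : algebraMap k[X] (RatFunc k) c.denom ≠ 0 :=
    (map_ne_zero_iff _ (IsFractionRing.injective k[X] (RatFunc k))).mpr c.denom_ne_zero
  have hc : algebraMap k[X] (RatFunc k) c.num = c * algebraMap k[X] (RatFunc k) c.denom :=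
    (div_eq_iff hB).mp (RatFunc.num_div_denom c)
  have hX : Φ X = algebraMap (RatFunc k) _ RatFunc.X :=
    congrArg (algebraMap (RatFunc k) _) RatFunc.algebraMap_X
  have hA : Φ c.num = algebraMap (RatFunc k) _ c * Φ c.denom := by
    change algebraMap (RatFunc k) _ _ = _ * algebraMap (RatFunc k) _ _
    rw [hc, map_mul]
  simp only [dotProduct, Fin.sum_univ_three, lineVec, pointVec, Matrix.cons_val, map_neg, map_mul,
    hX, hA]
  ring

/-- The abscissa `x` is a ratio of linear forms over `k` in the coordinates, so it would be
algebraic if all ratios of coordinates were. -/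
theorem exists_transcendental_ratio {M N : Matrix (Fin 3) (Fin 3) k} (hMN : M * N = 1)
    {c : RatFunc k} {x : AlgebraicClosure (RatFunc k)} (hx : Transcendental k x) :
    ∃ i j, Transcendental k
      ((M.map (algebraMap k (AlgebraicClosure (RatFunc k))) *ᵥ pointVec c x) i /
        (M.map (algebraMap k (AlgebraicClosure (RatFunc k))) *ᵥ pointVec c x) j) := by
  set v := M.map (algebraMap k (AlgebraicClosure (RatFunc k))) *ᵥ pointVec c x with hv
  have hN : N.map (algebraMap k (AlgebraicClosure (RatFunc k))) *ᵥ v = pointVec c x :=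
    mulVec_map_mulVec_map hMN _
  by_contra! h
  obtain ⟨l, hl⟩ : ∃ l, v l ≠ 0 := by
    by_contra! h0
    have h1 := congrFun hN 2
    rw [show v = 0 from funext h0, Matrix.mulVec_zero] at h1
    simp [pointVec] at h1
  have hmem : ∀ i, (N.map (algebraMap k (AlgebraicClosure (RatFunc k))) *ᵥ v) i / v l ∈
      algebraicClosure k (AlgebraicClosure (RatFunc k)) := by
    intro i
    simp only [Matrix.mulVec, dotProduct, Finset.sum_div, mul_div_assoc, Matrix.map_apply]
    refine sum_mem fun j _ => mul_mem (IntermediateField.algebraMap_mem _ _) ?_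
    exact mem_algebraicClosure_iff.mpr (not_not.mp (h j l))
  rw [hN] at hmem
  have h12 := div_mem (hmem 1) (hmem 2)
  rw [div_div_div_cancel_right₀ hl] at h12
  simp only [pointVec, Matrix.cons_val, div_one] at h12
  exact hx (mem_algebraicClosure_iff.mp h12)

/-- The point comes from Cardano's root. The absence of roots in `k(t)` makes it non-constant and
keeps `x` outside `k(t)`; the latter is recorded for the proof of inequivalence. -/
theorem exists_pseudoParam (h2 : (2 : k) ≠ 0) (h3 : (3 : k) ≠ 0) {a b κ : k}
    (hd : 4 * a ^ 3 + 27 * b ^ 2 ≠ 0) {M N : Matrix (Fin 3) (Fin 3) k} (hMN : M * N = 1)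
    {c w : RatFunc k} (hw0 : w ≠ 0)
    (hw : w ^ 2 = -3 * lineDisc (RatFunc.C a) (RatFunc.C b) RatFunc.X c) :
    ∃ P : PseudoParam (MvPolynomial.C κ * subst N (weier a b)), P.IsGivenBy (lineCurve hMN c) ∧
      ∃ x, x ∉ Set.range (algebraMap (RatFunc k) (AlgebraicClosure (RatFunc k))) ∧
        P.coord = M.map (algebraMap k (AlgebraicClosure (RatFunc k))) *ᵥ pointVec c x := by
  have h2K : (2 : RatFunc k) ≠ 0 := by
    rw [← map_ofNat RatFunc.C 2]; exact (_root_.map_ne_zero _).mpr h2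
  have h3K : (3 : RatFunc k) ≠ 0 := by
    rw [← map_ofNat RatFunc.C 3]; exact (_root_.map_ne_zero _).mpr h3
  obtain ⟨R, ρ, x, hρ, hxρ, hx⟩ :=
    exists_cubic_radical (Ω := AlgebraicClosure (RatFunc k)) h2K h3K hw0 hw
  rw [← map_pow] at hx
  have hno := cubic_ne_zero h2 h3 hd hw
  have hX : Transcendental k ((RatFunc.X : RatFunc k) ^ 2) :=
    RatFunc.transcendental_X.pow two_pos
  have htr : Transcendental k x := transcendental_of_cubic hX hno hx
  have hmem : ∀ i, pointVec c x i ∈ IntermediateField.adjoin (RatFunc k) {ρ} := by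
    intro i
    fin_cases i
    · exact add_mem (mul_mem (IntermediateField.algebraMap_mem _ _) hxρ)
        (IntermediateField.algebraMap_mem _ _)
    · exact hxρ
    · exact one_mem _
  refine ⟨{ radicand := R
            root := ρ
            root_pow := hρ
            coord := M.map (algebraMap k (AlgebraicClosure (RatFunc k))) *ᵥ pointVec c x
            coord_mem := fun i => ?_
            on_curve := aeval_mulVec_pointVec hMN hx
            nonconstant := exists_transcendental_ratio hMN htr },
    dotProduct_lineCurve_pointVec hMN c x, x, ?_, rfl⟩
  · simp only [Matrix.mulVec, dotProduct, Matrix.map_apply]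
    refine sum_mem fun j _ => mul_mem ?_ (hmem j)
    rw [IsScalarTower.algebraMap_apply k (RatFunc k) (AlgebraicClosure (RatFunc k))]
    exact IntermediateField.algebraMap_mem _ _
  · rintro ⟨x₀, rfl⟩
    apply hno x₀
    apply (algebraMap (RatFunc k) (AlgebraicClosure (RatFunc k))).injective
    rw [map_zero, ← hx]
    simp only [map_add, map_mul, map_pow, map_sub]

/-- After the change of variable the same point lies on `y = t x + c'` and on `y = φ(t) x + φ(c)`.
Two lines over `k(t)` with distinct slopes meet at a point over `k(t)`, contrary to the choice of
`x'`. So `φ(t) = t`, hence `φ` is the identity and `c = c'`. -/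
theorem eq_of_equivalent {F : MvPolynomial (Fin 3) k} {M N : Matrix (Fin 3) (Fin 3) k}
    (hMN : M * N = 1) {c c' : RatFunc k} {P P' : PseudoParam F}
    {x x' : AlgebraicClosure (RatFunc k)}
    (hx' : x' ∉ Set.range (algebraMap (RatFunc k) (AlgebraicClosure (RatFunc k))))
    (hP : P.coord = M.map (algebraMap k (AlgebraicClosure (RatFunc k))) *ᵥ pointVec c x)
    (hP' : P'.coord = M.map (algebraMap k (AlgebraicClosure (RatFunc k))) *ᵥ pointVec c' x')
    (h : P.Equivalent P') : c = c' := by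
  obtain ⟨φ, σ, hσ, d, -, hd⟩ := h
  have hk : ∀ r : k, σ (algebraMap k _ r) = algebraMap k _ r := by
    intro r
    rw [IsScalarTower.algebraMap_apply k (RatFunc k) (AlgebraicClosure (RatFunc k)), hσ,
      AlgEquiv.commutes]
  have hv : pointVec c' x' = d • fun i => σ (pointVec c x i) := by
    rw [← mulVec_map_mulVec_map hMN (pointVec c' x'), ← hP',
      ← mulVec_map_mulVec_map hMN (fun i => σ (pointVec c x i)), ← Matrix.mulVec_smul]
    congr 1
    funext i
    rw [hd i, hP]
    simp only [Matrix.mulVec, dotProduct, map_sum, map_mul, Matrix.map_apply, hk, Pi.smul_apply,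
      smul_eq_mul]
  have h0 := congrFun hv 0
  have h1 := congrFun hv 1
  have h2 := congrFun hv 2
  simp only [pointVec, Matrix.cons_val, Pi.smul_apply, smul_eq_mul, map_add, map_mul, map_one,
    mul_one, hσ] at h0 h1 h2
  rw [← h2, one_mul] at h0 h1
  rw [← h1] at h0
  have hφ : φ RatFunc.X = RatFunc.X := by
    by_contra hne
    have hne' : RatFunc.X - φ RatFunc.X ≠ 0 := sub_ne_zero.mpr (Ne.symm hne)
    apply hx'
    refine ⟨(φ c - c') / (RatFunc.X - φ RatFunc.X), ?_⟩
    rw [map_div₀, div_eq_iff ((_root_.map_ne_zero _).mpr hne'), map_sub, map_sub]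
    linear_combination -h0
  have hφc := algEquiv_apply_eq_of_apply_X hφ c
  rw [hφ, hφc] at h0
  exact ((algebraMap (RatFunc k) (AlgebraicClosure (RatFunc k))).injective
    (add_left_cancel h0)).symm

/-- If the discriminant vanished, the cubic would have a multiple root in `k(t)`, which
`cubic_ne_zero` excludes. -/
theorem discriminant_sqrt_ne_zero (h2 : (2 : k) ≠ 0) (h3 : (3 : k) ≠ 0) {a b : k}
    (hd : 4 * a ^ 3 + 27 * b ^ 2 ≠ 0) {c w : RatFunc k}
    (hw : w ^ 2 = -3 * lineDisc (RatFunc.C a) (RatFunc.C b) RatFunc.X c) : w ≠ 0 := by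
  have h2K : (2 : RatFunc k) ≠ 0 := by
    rw [← map_ofNat RatFunc.C 2]; exact (_root_.map_ne_zero _).mpr h2
  have h3K : (3 : RatFunc k) ≠ 0 := by
    rw [← map_ofNat RatFunc.C 3]; exact (_root_.map_ne_zero _).mpr h3
  rintro rfl
  have h0 : lineDisc (RatFunc.C a) (RatFunc.C b) RatFunc.X c = 0 := by
    apply (mul_eq_zero.mp _).resolve_left (neg_ne_zero.mpr h3K)
    rw [← hw]
    ring
  obtain ⟨x, hx⟩ := exists_cubic_eq_zero_of_lineDisc_eq_zero h2K h3K h0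
  exact cubic_ne_zero h2 h3 hd hw x hx

end Param

end CubicRadicals

/-! ### Assembly: one curve and one pseudo-parameterization for each admissible `c` -/

theorem mainTheorem3 {k : Type*} [Field k] (h2 : (2 : k) ≠ 0) (h3 : (3 : k) ≠ 0)
    (F : MvPolynomial (Fin 3) k) (hF : CubicRadicals.IsSmoothCubic F)
    (p : Fin 3 → k) (hp : CubicRadicals.IsFlex F p) :
    ∃ (L : ℕ → CubicRadicals.RationalCurve k) (P : ℕ → CubicRadicals.PseudoParam F),
      (Function.Injective fun n => (L n).carrier) ∧
      (∀ n, (L n).MeetsDualEvenly F) ∧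
      (∀ n, (L n).IsSectionOfPencil (CubicRadicals.gradient F p)) ∧
      (∀ n, (P n).IsGivenBy (L n)) ∧
      (∀ m n, m ≠ n → ¬ (P m).Equivalent (P n)) := by
  obtain ⟨a, b, κ, M, N, hMN, hκ, hd, rfl, hNp⟩ :=
    CubicRadicals.exists_weierstrass_form h2 h3 hF hp
  -- Distinct indices give distinct `c`, and `c` can be recovered both from the curve and from the
  -- equivalence class of the pseudo-parameterization.
  let e := (CubicRadicals.infinite_setOf_lineDisc h2 h3 hd).natEmbedding
  choose w hw using fun n => (e n).2
  have hw0 := fun n => CubicRadicals.discriminant_sqrt_ne_zero h2 h3 hd (hw n)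
  choose P hP x hx hPx using fun n =>
    CubicRadicals.exists_pseudoParam (κ := κ) h2 h3 hd hMN (hw0 n) (hw n)
  have he : ∀ {m n}, (e m : RatFunc k) = e n → m = n := fun h => e.injective (Subtype.ext h)
  refine ⟨fun n => CubicRadicals.lineCurve hMN (e n), P, ?_, ?_, ?_, hP, ?_⟩
  · exact fun m n h => he (CubicRadicals.eq_of_carrier_lineCurve_eq hMN h)
  · exact fun n => CubicRadicals.lineCurve_meetsDualEvenly h2 h3 hd hκ hMN (hw0 n) (hw n)
  · exact fun n => CubicRadicals.lineCurve_isSectionOfPencil hMN _ hκ hNp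
  · exact fun m n hmn h => hmn (he (CubicRadicals.eq_of_equivalent hMN (hx n) (hPx m) (hPx n) h))
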